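/- \textbf{Definitions.} Let $G$ be a group generated by a finite set $S$, and let $\gamma_S(n)$ be the number of elements of $G$ that are products of at most $n$ elements of $S\cup S^{-1}$. A finitely generated group $G$ has \emph{intermediate growth} if $\gamma_S$ is neither bounded above by a polynomial in $n$ nor bounded below by $c^n$ for some $c>1$ (this does not depend on the choice of the finite generating set $S$). A group $G$ is \emph{amenable} if there is a finitely additive map $\mu$ from the set of all subsets of $G$ to $[0,1]$ with $\mu(G)=1$ and $\mu(A)=\mu(gA)=\mu(Ag)$ for all $A\subseteq G$, $g\in G$. The class of \emph{elementary amenable} groups is the smallest class of groups that contains $\mathbb{Z}$ and all finite groups and is closed under isomorphism, subgroups, quotients, extensions and directed unions. Grigorchuk's torsion-free group is the group $\Gamma$ of permutations of the set $\mathbb{Z}^{\mathbb{N}}$ of integer sequences generated by $a,b,c,d$, where $a(l_0,l_1,l_2,\dots)=(l_0+1,l_1,l_2,\dots)$ and $b,c,d$ are defined recursively by: if $l_0$ is even, $$b(l_0,l_1,\dots)=(l_0,a(l_1,l_2,\dots)),\quad c(l_0,l_1,\dots)=(l_0,a(l_1,l_2,\dots)),\quad d(l_0,l_1,\dots)=(l_0,l_1,l_2,\dots);$$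 if $l_0$ is odd, $$b(l_0,l_1,\dots)=(l_0,c(l_1,l_2,\dots)),\quad c(l_0,l_1,\dots)=(l_0,d(l_1,l_2,\dots)),\quad d(l_0,l_1,\dots)=(l_0,b(l_1,l_2,\dots)).$$ \textbf{Proposition.} Let $G$ be a group of intermediate growth and let $k$ be a field such that the group algebra $kG$ is a domain. Then $G$ is amenable but not elementary amenable. Moreover, such groups exist: Grigorchuk's group $\Gamma$ is torsion-free and of intermediate growth, and $k\Gamma$ is a domain for every field $k$. -/

import Mathlib

universe u

section Growth

open scoped Pointwise

/-- The growth function of `G` with respect to `S`: the number of elements of `G` that are products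
of at most `n` elements of `S ∪ S⁻¹`. -/
noncomputable def groupGrowth {G : Type u} [Group G] (S : Set G) (n : ℕ) : ℕ :=
  (({1} ∪ S ∪ S⁻¹ : Set G) ^ n).ncard

/-- `f` is bounded above by a polynomial. -/
def PolynomiallyBounded (f : ℕ → ℕ) : Prop :=
  ∃ C d : ℕ, ∀ n : ℕ, f n ≤ C * (n + 1) ^ d

/-- `f` is bounded below by an exponential function with base greater than one. -/
def ExponentiallyGrowing (f : ℕ → ℕ) : Prop :=
  ∃ c : ℝ, 1 < c ∧ ∀ n : ℕ, c ^ n ≤ (f n : ℝ)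

/-- `G` is a finitely generated group whose growth (with respect to a finite generating set; the
choice does not matter) is neither polynomial nor exponential. -/
def HasIntermediateGrowth (G : Type u) [Group G] : Prop :=
  ∃ S : Set G, S.Finite ∧ Subgroup.closure S = ⊤ ∧
    ¬ PolynomiallyBounded (groupGrowth S) ∧ ¬ ExponentiallyGrowing (groupGrowth S)

end Growth

/-- A group is amenable if it has a finitely additive probability measure, defined on all subsets,
which is invariant under left and right translations. -/
def IsAmenableGroup (G : Type u) [Group G] : Prop :=
  ∃ μ : Set G → ℝ,
    (∀ A, μ A ∈ Set.Icc (0 : ℝ) 1) ∧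
    μ Set.univ = 1 ∧
    (∀ A B : Set G, A ∩ B = ∅ → μ (A ∪ B) = μ A + μ B) ∧
    (∀ (A : Set G) (g : G),
      μ A = μ ((fun x => g * x) '' A) ∧ μ A = μ ((fun x => x * g) '' A))

/-- Elementary amenable groups: the smallest (isomorphism-closed) class of groups that contains
`ℤ` and all finite groups and is closed under taking subgroups, quotients, extensions, and
directed unions. -/
inductive IsElementaryAmenable : (G : Type u) → [Group G] → Prop
  | ofInt (G : Type u) [Group G] (e : Multiplicative ℤ ≃* G) : IsElementaryAmenable G
  | ofFinite (G : Type u) [Group G] (h : Finite G) : IsElementaryAmenable G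
  | ofIso (G G' : Type u) [Group G] [Group G'] (e : G ≃* G') (h : IsElementaryAmenable G) :
      IsElementaryAmenable G'
  | subgroup (G : Type u) [Group G] (H : Subgroup G) (h : IsElementaryAmenable G) :
      IsElementaryAmenable H
  | quotient (G : Type u) [Group G] (N : Subgroup G) [N.Normal] (h : IsElementaryAmenable G) :
      IsElementaryAmenable (G ⧸ N)
  | extension (G : Type u) [Group G] (N : Subgroup G) [N.Normal] (hN : IsElementaryAmenable N)
      (hQ : IsElementaryAmenable (G ⧸ N)) : IsElementaryAmenable G
  | directedUnion (G : Type u) [Group G] (S : Set (Subgroup G)) (hne : S.Nonempty)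
      (hdir : DirectedOn (fun H K => H ≤ K) S) (hunion : ∀ g : G, ∃ H ∈ S, g ∈ H)
      (h : ∀ H ∈ S, IsElementaryAmenable H) : IsElementaryAmenable G

namespace Grigorchuk

/-- Names of the three generators `b`, `c`, `d`. -/
inductive Letter
  | b
  | c
  | d

/-- The cyclic permutation `b ↦ c ↦ d ↦ b`. -/
def Letter.next : Letter → Letter
  | .b => .c
  | .c => .d
  | .d => .b

/-- How much `b`, `c`, `d` shift the second coordinate if the first one is even. -/
def Letter.shift : Letter → ℤ
  | .b => 1
  | .c => 1
  | .d => 0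

/-- `shiftHead m (l₀, l₁, l₂, …) = (l₀ + m, l₁, l₂, …)`. -/
def shiftHead (m : ℤ) (l : ℕ → ℤ) : ℕ → ℤ
  | 0 => l 0 + m
  | n + 1 => l (n + 1)

/-- The action of the letter `s` (for `e = 1`) or of its inverse (for `e = -1`) on integer
sequences: `(l₀, l₁, l₂, …)` is sent to `(l₀, l₁ + e * s.shift, l₂, …)` if `l₀` is even,
and to `(l₀, act e s.next (l₁, l₂, …))` if `l₀` is odd. -/
def act (e : ℤ) : Letter → (ℕ → ℤ) → ℕ → ℤ
  | _, l, 0 => l 0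
  | s, l, n + 1 =>
    if Even (l 0) then shiftHead (e * s.shift) (fun i => l (i + 1)) n
    else act e s.next (fun i => l (i + 1)) n

theorem shiftHead_neg (m : ℤ) (l : ℕ → ℤ) : shiftHead (-m) (shiftHead m l) = l := by
  funext n
  cases n <;> simp [shiftHead]

theorem act_neg (e : ℤ) (s : Letter) (l : ℕ → ℤ) (n : ℕ) : act (-e) s (act e s l) n = l n := by
  induction n generalizing s l with
  | zero => rfl
  | succ n ih =>
    have h0 : act e s l 0 = l 0 := rfl
    by_cases h : Even (l 0)
    · have ht : (fun i => act e s l (i + 1)) =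
          shiftHead (e * s.shift) (fun i => l (i + 1)) := by
        funext i
        simp [act, h]
      rw [act, h0, if_pos h, ht, neg_mul, shiftHead_neg]
    · have ht : (fun i => act e s l (i + 1)) = act e s.next (fun i => l (i + 1)) := by
        funext i
        simp [act, h]
      rw [act, h0, if_neg h, ht, ih]

/-- The generator `a : (l₀, l₁, l₂, …) ↦ (l₀ + 1, l₁, l₂, …)`. -/
def genA : Equiv.Perm (ℕ → ℤ) where
  toFun := shiftHead 1
  invFun := shiftHead (-1)
  left_inv := shiftHead_neg 1
  right_inv l := by simpa using shiftHead_neg (-1) l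

/-- The generators `b`, `c`, `d`: on sequences with even first entry they act as
`b = (l₀, a(l₁, l₂, …))`, `c = (l₀, a(l₁, l₂, …))`, `d = (l₀, l₁, l₂, …)`, and on sequences with odd
first entry as `b = (l₀, c(l₁, l₂, …))`, `c = (l₀, d(l₁, l₂, …))`, `d = (l₀, b(l₁, l₂, …))`. -/
def gen (s : Letter) : Equiv.Perm (ℕ → ℤ) where
  toFun := act 1 s
  invFun := act (-1) s
  left_inv l := funext (act_neg 1 s l)
  right_inv l := funext fun n => by simpa using act_neg (-1) s l n

/-- Grigorchuk's torsion-free group: the group of permutations of the set of integer sequences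
that is generated by `a`, `b`, `c` and `d`. -/
def torsionFreeGroup : Subgroup (Equiv.Perm (ℕ → ℤ)) :=
  Subgroup.closure {genA, gen .b, gen .c, gen .d}

end Grigorchuk

/-!
Both halves of the first claim hold for every group `G` of intermediate growth.

*Amenability.* Since the growth is not exponential, there are radii for which the sphere around a
ball is arbitrarily small compared with the ball. These balls are almost invariant under left and
right translations by generators, and an ultrafilter limit of the densities in them is a two-sided
invariant mean (`HasIntermediateGrowth.isAmenableGroup`).

*No elementary amenable group has intermediate growth* (Chou's theorem). By Milnor's lemma
(`LocallySubexponential.fg_of_cyclic_step`), in a finitely generated group of subexponential growth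
the kernel of a homomorphism to a cyclic group is finitely generated. So the following property of a
group passes to subgroups, quotients, extensions and directed unions: every finitely generated
section of subexponential growth is built from the trivial group by finitely many cyclic and
finite-index steps (`IsElementaryAmenable.subexponentialSectionsPolycyclic`). Such a group has
polynomial growth if it has subexponential growth (the Milnor–Wolf theorem,
`IsPolycyclicOrFinite.polynomiallyBounded`). Indeed, in a cyclic step, in which `t` is added, the
eigenvalues of `t` on the abelian factors of a solvable subgroup of finite index lie in the closed
unit disc, because a larger eigenvalue would force exponential growth
(`LocallySubexponential.norm_eigenvalue_le_one`). By Kronecker's theorem a power of `t` acts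
unipotently on these factors (`LinearEquiv.exists_pow_sub_one_pow_eq_zero`), and so the conjugates
of an element by the powers of `t` have polynomially bounded length
(`LocallySubexponential.le_tameSubgroup`).

*Grigorchuk's group* `Γ` preserves the lexicographic order on the integer sequences. Hence it has a
left-invariant total order (`Grigorchuk.exists_leftOrder`), it is torsion-free, and its group
algebras have no zero divisors.

An element of `Γ` is given by the shift of the first entry and by its two sections, which act on the
remaining entries of the sequences with even and with odd first entry (`Grigorchuk.wr`). The growth
of `Γ` is not polynomial because `Γ` contains free abelian groups of all ranks: the nontrivial
commutators of elements of `Γ` with conjugates of `b ^ 2`, `c ^ 2`, `d ^ 2` can be moved into each of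
the two sections, since the element `a ^ 2` is central (`Grigorchuk.squareCommutators`). The growth
is not exponential because the two sections of an element are together shorter by a constant factor,
in a suitable weight (`Grigorchuk.HasNormalForm.exists_sections`). The weight ignores the exponents
of the letters, but in the ball of radius `n` these are at most `n`. After about `log n` levels of
sections, an element is described by sublinearly many numbers of polynomial size
(`Grigorchuk.ncard_normalFormSet_le`).
-/

/-! ### Growth functions of groups -/

section GrowthBasics

open scoped Pointwise

/-- The ball of radius `n` around `1` in the word metric given by `S`. -/
def wordBall {G : Type*} [Group G] (S : Set G) (n : ℕ) : Set G :=
  ({1} ∪ S ∪ S⁻¹ : Set G) ^ n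

variable {G H : Type*} [Group G] [Group H] {S T : Set G}

theorem one_mem_wordBall (S : Set G) (n : ℕ) : (1 : G) ∈ wordBall S n :=
  Set.one_mem_pow (by simp)

theorem wordBall_finite (hS : S.Finite) (n : ℕ) : (wordBall S n).Finite := by
  have h1 : (({1} ∪ S ∪ S⁻¹ : Set G)).Finite := ((Set.finite_singleton 1).union hS).union hS.inv
  induction n with
  | zero => simp [wordBall, ← Set.singleton_one]
  | succ n ih =>
    rw [wordBall, pow_succ]
    exact ih.mul h1

theorem wordBall_mono_right (S : Set G) {m n : ℕ} (h : m ≤ n) : wordBall S m ⊆ wordBall S n :=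
  Set.pow_subset_pow_right (by simp) h

theorem wordBall_mono_left (h : S ⊆ T) (n : ℕ) : wordBall S n ⊆ wordBall T n :=
  Set.pow_subset_pow_left
    (Set.union_subset_union (Set.union_subset_union_right _ h) (Set.inv_subset_inv.2 h))

theorem wordBall_add (S : Set G) (m n : ℕ) : wordBall S (m + n) = wordBall S m * wordBall S n :=
  pow_add _ _ _

theorem wordBall_mul (S : Set G) (m n : ℕ) : wordBall S (m * n) = wordBall S m ^ n :=
  pow_mul _ _ _

theorem wordBall_zero (S : Set G) : wordBall S 0 = {1} := by
  simp [wordBall, ← Set.singleton_one]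

theorem wordBall_one (S : Set G) : wordBall S 1 = {1} ∪ S ∪ S⁻¹ :=
  pow_one _

theorem subset_wordBall_one (S : Set G) : S ⊆ wordBall S 1 := by
  rw [wordBall_one]
  intro x hx
  exact Or.inl (Or.inr hx)

theorem mul_mem_wordBall {m n : ℕ} {x y : G} (hx : x ∈ wordBall S m) (hy : y ∈ wordBall S n) :
    x * y ∈ wordBall S (m + n) := by
  rw [wordBall_add]
  exact Set.mul_mem_mul hx hy

theorem wordBall_inv (S : Set G) (n : ℕ) : (wordBall S n)⁻¹ = wordBall S n := by
  have h : (({1} ∪ S ∪ S⁻¹ : Set G))⁻¹ = {1} ∪ S ∪ S⁻¹ := by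
    rw [Set.union_inv, Set.union_inv, inv_inv, Set.inv_singleton, inv_one, Set.union_right_comm]
  rw [wordBall, ← inv_pow, h]

theorem inv_mem_wordBall {n : ℕ} {x : G} (hx : x ∈ wordBall S n) : x⁻¹ ∈ wordBall S n := by
  rw [← wordBall_inv]
  exact Set.inv_mem_inv.2 hx

theorem pow_mem_wordBall {m : ℕ} {x : G} (hx : x ∈ wordBall S m) (n : ℕ) :
    x ^ n ∈ wordBall S (m * n) := by
  rw [wordBall_mul]
  exact Set.pow_mem_pow hx

theorem wordBall_subset_closure (S : Set G) (n : ℕ) :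
    wordBall S n ⊆ (Subgroup.closure S : Set G) := by
  induction n with
  | zero => simp [wordBall_zero]
  | succ n ih =>
    rw [wordBall_add, wordBall_one]
    rintro _ ⟨x, hx, y, hy, rfl⟩
    refine mul_mem (ih hx) ?_
    rcases hy with (hy | hy) | hy
    · rw [Set.mem_singleton_iff.1 hy]
      exact one_mem _
    · exact Subgroup.subset_closure hy
    · exact inv_mem_iff.1 (Subgroup.subset_closure hy)

theorem exists_mem_wordBall {x : G} (hx : x ∈ Subgroup.closure S) : ∃ n, x ∈ wordBall S n := by
  induction hx using Subgroup.closure_induction with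
  | mem x hx => exact ⟨1, subset_wordBall_one S hx⟩
  | one => exact ⟨0, one_mem_wordBall S 0⟩
  | mul x y _ _ hx hy =>
    obtain ⟨m, hm⟩ := hx
    obtain ⟨n, hn⟩ := hy
    exact ⟨m + n, mul_mem_wordBall hm hn⟩
  | inv x _ hx =>
    obtain ⟨m, hm⟩ := hx
    exact ⟨m, inv_mem_wordBall hm⟩

/-- A finite subset of `⟨S⟩` lies in some ball. -/
theorem exists_subset_wordBall {F : Set G} (hF : F.Finite)
    (h : F ⊆ (Subgroup.closure S : Set G)) : ∃ n, F ⊆ wordBall S n := by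
  induction F, hF using Set.Finite.induction_on with
  | empty => exact ⟨0, Set.empty_subset _⟩
  | @insert a F _ _ ih =>
    obtain ⟨n, hn⟩ := ih ((Set.subset_insert _ _).trans h)
    obtain ⟨m, hm⟩ := exists_mem_wordBall (h (Set.mem_insert a F))
    refine ⟨max m n, Set.insert_subset ?_ ?_⟩
    · exact wordBall_mono_right S (le_max_left _ _) hm
    · exact hn.trans (wordBall_mono_right S (le_max_right _ _))

theorem wordBall_subset_of_subset {k : ℕ} (h : S ⊆ wordBall T k) (n : ℕ) :
    wordBall S n ⊆ wordBall T (k * n) := by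
  rw [wordBall_mul]
  refine Set.pow_subset_pow_left (Set.union_subset (Set.union_subset ?_ h) ?_)
  · simpa using one_mem_wordBall T k
  · rw [← wordBall_inv]
    exact Set.inv_subset_inv.2 h

theorem image_wordBall (f : G →* H) (S : Set G) (n : ℕ) :
    f '' wordBall S n = wordBall (f '' S) n := by
  rw [wordBall, wordBall, Set.image_pow, Set.image_union, Set.image_union, Set.image_singleton,
    map_one, Set.image_inv]

theorem groupGrowth_eq (S : Set G) (n : ℕ) : groupGrowth S n = (wordBall S n).ncard := rfl

theorem groupGrowth_pos (hS : S.Finite) (n : ℕ) : 0 < groupGrowth S n :=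
  (Set.ncard_pos (wordBall_finite hS n)).2 ⟨1, one_mem_wordBall S n⟩

theorem groupGrowth_mono (hS : S.Finite) {m n : ℕ} (h : m ≤ n) :
    groupGrowth S m ≤ groupGrowth S n :=
  Set.ncard_le_ncard (wordBall_mono_right S h) (wordBall_finite hS n)

theorem ncard_pow_le (A : Set G) (n : ℕ) : (A ^ n).ncard ≤ A.ncard ^ n := by
  induction n with
  | zero => simp [← Set.singleton_one]
  | succ n ih =>
    rw [pow_succ, pow_succ]
    exact (Set.natCard_mul_le).trans (Nat.mul_le_mul_right _ ih)

theorem groupGrowth_mul_le (S : Set G) (m n : ℕ) :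
    groupGrowth S (m * n) ≤ groupGrowth S m ^ n := by
  rw [groupGrowth_eq, groupGrowth_eq, wordBall_mul]
  exact ncard_pow_le _ _

theorem groupGrowth_le_of_subset {k : ℕ} (hT : T.Finite) (h : S ⊆ wordBall T k) (n : ℕ) :
    groupGrowth S n ≤ groupGrowth T (k * n) :=
  Set.ncard_le_ncard (wordBall_subset_of_subset h n) (wordBall_finite hT _)

/-- Exponential growth can be tested along multiples of a fixed number. -/
theorem ExponentiallyGrowing.of_mul {c : ℝ} (hc : 1 < c) (m : ℕ)
    (h : ∀ n, c ^ n ≤ (groupGrowth S (m * n) : ℝ)) : ExponentiallyGrowing (groupGrowth S) := by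
  have hm : m ≠ 0 := by
    rintro rfl
    have := h 1
    simp [groupGrowth_eq, wordBall_zero] at this
    linarith
  refine ⟨c ^ (1 / m : ℝ), Real.one_lt_rpow hc (by positivity), fun n => ?_⟩
  have h1 : c ^ n ≤ (groupGrowth S n : ℝ) ^ m := by
    refine (h n).trans ?_
    rw [mul_comm]
    exact_mod_cast groupGrowth_mul_le S n m
  have h0 : (0 : ℝ) ≤ c := by linarith
  refine le_of_pow_le_pow_left₀ hm (Nat.cast_nonneg _) (le_trans (le_of_eq ?_) h1)
  rw [← pow_mul, mul_comm n m, pow_mul, ← Real.rpow_natCast _ m, ← Real.rpow_mul h0]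
  rw [one_div, inv_mul_cancel₀ (by exact_mod_cast hm), Real.rpow_one]

theorem ExponentiallyGrowing.of_subset {k : ℕ} (hT : T.Finite) (h : S ⊆ wordBall T k)
    (hS : ExponentiallyGrowing (groupGrowth S)) : ExponentiallyGrowing (groupGrowth T) := by
  obtain ⟨c, hc, hn⟩ := hS
  refine .of_mul hc k fun n => (hn n).trans ?_
  exact_mod_cast groupGrowth_le_of_subset hT h n

theorem PolynomiallyBounded.of_le_comp {f g : ℕ → ℕ} (hg : PolynomiallyBounded g) (C d : ℕ)
    (h : ∀ n, f n ≤ g (C * (n + 1) ^ d)) : PolynomiallyBounded f := by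
  obtain ⟨A, e, hg⟩ := hg
  refine ⟨A * (C + 1) ^ e, d * e, fun n => (h n).trans ((hg _).trans ?_)⟩
  rw [mul_assoc, pow_mul, ← mul_pow]
  gcongr
  have : 1 ≤ (n + 1) ^ d := Nat.one_le_pow _ _ (by omega)
  nlinarith

theorem PolynomiallyBounded.mul {f g : ℕ → ℕ} (hf : PolynomiallyBounded f)
    (hg : PolynomiallyBounded g) : PolynomiallyBounded fun n => f n * g n := by
  obtain ⟨A, d, hf⟩ := hf
  obtain ⟨B, e, hg⟩ := hg
  refine ⟨A * B, d + e, fun n => (Nat.mul_le_mul (hf n) (hg n)).trans (le_of_eq ?_)⟩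
  ring

theorem PolynomiallyBounded.mono {f g : ℕ → ℕ} (hg : PolynomiallyBounded g)
    (h : ∀ n, f n ≤ g n) : PolynomiallyBounded f := by
  obtain ⟨A, d, hg⟩ := hg
  exact ⟨A, d, fun n => (h n).trans (hg n)⟩

theorem PolynomiallyBounded.of_subset {k : ℕ} (hT : T.Finite) (h : S ⊆ wordBall T k)
    (hp : PolynomiallyBounded (groupGrowth T)) : PolynomiallyBounded (groupGrowth S) :=
  hp.of_le_comp k 1 fun n => (groupGrowth_le_of_subset hT h n).trans
    (groupGrowth_mono hT (by simp [mul_add]))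

/-- No finite subset of `G` generates a subgroup of exponential growth. -/
def LocallySubexponential (G : Type*) [Group G] : Prop :=
  ∀ S : Set G, S.Finite → ¬ ExponentiallyGrowing (groupGrowth S)

theorem HasIntermediateGrowth.locallySubexponential {G : Type*} [Group G]
    (h : HasIntermediateGrowth G) : LocallySubexponential G := by
  obtain ⟨S, hS, htop, -, hexp⟩ := h
  intro T hT hTe
  obtain ⟨k, hk⟩ := exists_subset_wordBall (S := S) hT (by simp [htop])
  exact hexp (hTe.of_subset hS hk)

theorem groupGrowth_image_le (f : G →* H) (hS : S.Finite) (n : ℕ) :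
    groupGrowth (f '' S) n ≤ groupGrowth S n := by
  rw [groupGrowth_eq, ← image_wordBall]
  exact Set.ncard_image_le (wordBall_finite hS n)

theorem groupGrowth_image_of_injective (f : G →* H) (hf : Function.Injective f) (n : ℕ) :
    groupGrowth (f '' S) n = groupGrowth S n := by
  rw [groupGrowth_eq, ← image_wordBall]
  exact Set.ncard_image_of_injective _ hf

theorem LocallySubexponential.of_injective (h : LocallySubexponential H) (f : G →* H)
    (hf : Function.Injective f) : LocallySubexponential G := by
  intro S hS hexp
  refine h (f '' S) (hS.image f) ?_
  rwa [funext (groupGrowth_image_of_injective f hf)]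

theorem LocallySubexponential.of_surjective (h : LocallySubexponential G) (f : G →* H)
    (hf : Function.Surjective f) : LocallySubexponential H := by
  rintro S hS ⟨c, hc, hn⟩
  obtain ⟨T, hT, rfl⟩ : ∃ T : Set G, T.Finite ∧ f '' T = S := by
    refine ⟨Function.surjInv hf '' S, hS.image _, ?_⟩
    rw [Set.image_image]
    simp [Function.surjInv_eq]
  refine h T hT ⟨c, hc, fun n => (hn n).trans ?_⟩
  exact_mod_cast groupGrowth_image_le f hT n

end GrowthBasics

/-! ### Relations forced by subexponential growth -/

section MilnorRelation

variable {G : Type*} [Group G]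

/-- The product of the conjugates `t ^ i * h * t ^ (-i)` over those `i` at which the list has the
entry `true`, in increasing order of `i`. -/
def conjProd (h t : G) : List Bool → G
  | [] => 1
  | b :: l => (if b then h else 1) * (t * conjProd h t l * t⁻¹)

theorem conjProd_append (h t : G) (l : List Bool) (b : Bool) :
    conjProd h t (l ++ [b]) =
      conjProd h t l * (t ^ l.length * (if b then h else 1) * (t ^ l.length)⁻¹) := by
  induction l with
  | nil => simp [conjProd]
  | cons c l ih =>
    rw [List.cons_append, conjProd, ih, conjProd, List.length_cons, pow_succ']
    group

theorem conjProd_mem {h t : G} {K : Subgroup G} {l : List Bool}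
    (hK : ∀ i < l.length, t ^ i * h * (t ^ i)⁻¹ ∈ K) : conjProd h t l ∈ K := by
  induction l using List.reverseRecOn with
  | nil => exact one_mem _
  | append_singleton l b ih =>
    rw [conjProd_append]
    have h1 := hK l.length (by simp)
    refine mul_mem (ih fun i hi => hK i (by simp; omega)) ?_
    cases b
    · simp
    · simpa using h1

theorem conjProd_mul_pow_mem_wordBall (h t : G) (l : List Bool) :
    conjProd h t l * t ^ l.length ∈ wordBall {h, t} (2 * l.length) := by
  induction l with
  | nil => simpa [conjProd] using one_mem_wordBall _ _
  | cons b l ih =>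
    have e : conjProd h t (b :: l) * t ^ (b :: l).length =
        ((if b then h else 1) * t) * (conjProd h t l * t ^ l.length) := by
      rw [conjProd, List.length_cons, pow_succ']
      group
    rw [e, List.length_cons, mul_add, add_comm]
    refine mul_mem_wordBall (mul_mem_wordBall (m := 1) (n := 1) ?_ ?_) ih
    · cases b
      · simpa using one_mem_wordBall _ _
      · exact subset_wordBall_one _ (by simp)
    · exact subset_wordBall_one _ (by simp)

/-- If the `2 ^ n` words `h ^ ε₀ * t * h ^ ε₁ * t * ⋯ * h ^ εₙ₋₁ * t` were distinct for all `n`,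
the growth would be exponential. Two equal words give a relation between the conjugates of `h` by
powers of `t`, in which the last one occurs only once. -/
theorem LocallySubexponential.exists_conjProd_eq (hG : LocallySubexponential G) (h t : G) :
    ∃ p q : List Bool, p.length = q.length ∧
      conjProd h t p * (t ^ p.length * h * (t ^ p.length)⁻¹) = conjProd h t q := by
  by_contra! hcon
  have hinj : ∀ l l' : List Bool, l.length = l'.length → conjProd h t l = conjProd h t l' →
      l = l' := by
    intro l
    induction l using List.reverseRecOn with
    | nil =>
      intro l' hl _
      exact (List.length_eq_zero_iff.1 hl.symm).symm
    | append_singleton p b ih =>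
      intro l' hl he
      induction l' using List.reverseRecOn with
      | nil => simp at hl
      | append_singleton q c _ =>
        have hpq : p.length = q.length := by simpa using hl
        rw [conjProd_append, conjProd_append] at he
        cases b <;> cases c
        · rw [ih q hpq (by simpa using he)]
        · refine absurd ?_ (hcon q p hpq.symm)
          simpa using he.symm
        · refine absurd ?_ (hcon p q hpq)
          simpa using he
        · rw [hpq] at he
          rw [ih q hpq (by simpa using he)]
  have hfin : ({h, t} : Set G).Finite := Set.toFinite _
  refine hG {h, t} hfin (.of_mul (c := 2) (by norm_num) 2 fun n => ?_)
  let f : (Fin n → Bool) → G := fun ε => conjProd h t (List.ofFn ε) * t ^ n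
  have hf : Function.Injective f := by
    intro ε ε' he
    exact List.ofFn_injective (hinj _ _ (by simp) (mul_right_cancel he))
  have hsub : Set.range f ⊆ wordBall {h, t} (2 * n) := by
    rintro _ ⟨ε, rfl⟩
    have := conjProd_mul_pow_mem_wordBall h t (List.ofFn ε)
    rwa [List.length_ofFn] at this
  have hcard := Set.ncard_le_ncard hsub (wordBall_finite hfin _)
  rw [← Set.image_univ, Set.ncard_image_of_injective _ hf, Set.ncard_univ, Nat.card_eq_fintype_card,
    Fintype.card_fun, Fintype.card_bool, Fintype.card_fin] at hcard
  rw [groupGrowth_eq]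
  exact_mod_cast hcard

/-- The conjugates of an element by the positive powers of `t` lie in a finitely generated
subgroup generated by finitely many of them. -/
theorem LocallySubexponential.exists_pow_conj_mem (hG : LocallySubexponential G) (h t : G) :
    ∃ j : ℕ, ∀ n : ℕ, t ^ n * h * (t ^ n)⁻¹ ∈
      Subgroup.closure ((fun i : ℕ => t ^ i * h * (t ^ i)⁻¹) '' Set.Iio j) := by
  obtain ⟨p, q, hpq, he⟩ := hG.exists_conjProd_eq h t
  refine ⟨p.length, ?_⟩
  set A := Subgroup.closure ((fun i : ℕ => t ^ i * h * (t ^ i)⁻¹) '' Set.Iio p.length) with hA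
  have hlt : ∀ i < p.length, t ^ i * h * (t ^ i)⁻¹ ∈ A := fun i hi =>
    Subgroup.subset_closure ⟨i, hi, rfl⟩
  have hlast : t ^ p.length * h * (t ^ p.length)⁻¹ ∈ A := by
    rw [← eq_inv_mul_iff_mul_eq] at he
    rw [he]
    exact mul_mem (inv_mem (conjProd_mem hlt)) (conjProd_mem (by rwa [← hpq]))
  have hstep : ∀ x ∈ A, t * x * t⁻¹ ∈ A := by
    intro x hx
    have : A ≤ A.comap (MulAut.conj t).toMonoidHom := by
      rw [hA, Subgroup.closure_le, ← hA]
      rintro _ ⟨i, hi, rfl⟩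
      have hi' : i < p.length := hi
      have e : t * (t ^ i * h * (t ^ i)⁻¹) * t⁻¹ = t ^ (i + 1) * h * (t ^ (i + 1))⁻¹ := by
        rw [pow_succ']
        group
      change t * (t ^ i * h * (t ^ i)⁻¹) * t⁻¹ ∈ A
      rw [e]
      rcases (show i + 1 < p.length ∨ i + 1 = p.length by omega) with h1 | h1
      · exact hlt _ h1
      · rwa [h1]
    exact this hx
  have h0 : h ∈ A := by
    rcases Nat.eq_zero_or_pos p.length with h1 | h1
    · simpa [h1] using hlast
    · simpa using hlt 0 h1
  intro n
  induction n with
  | zero => simpa using h0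
  | succ n ih =>
    have e : t ^ (n + 1) * h * (t ^ (n + 1))⁻¹ = t * (t ^ n * h * (t ^ n)⁻¹) * t⁻¹ := by
      rw [pow_succ']
      group
    rw [e]
    exact hstep _ ih

theorem LocallySubexponential.exists_zpow_conj_mem (hG : LocallySubexponential G) (h t : G)
    {H : Subgroup G} (hH : ∀ n : ℤ, t ^ n * h * (t ^ n)⁻¹ ∈ H) :
    ∃ U : Set G, U.Finite ∧ U ⊆ H ∧ ∀ n : ℤ, t ^ n * h * (t ^ n)⁻¹ ∈ Subgroup.closure U := by
  obtain ⟨j, hj⟩ := hG.exists_pow_conj_mem h t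
  obtain ⟨k, hk⟩ := hG.exists_pow_conj_mem h t⁻¹
  refine ⟨_, ((Set.finite_Iio j).image fun i : ℕ => t ^ i * h * (t ^ i)⁻¹).union
    ((Set.finite_Iio k).image fun i : ℕ => t⁻¹ ^ i * h * (t⁻¹ ^ i)⁻¹), ?_, ?_⟩
  · refine Set.union_subset ?_ ?_
    · rintro _ ⟨i, -, rfl⟩
      simpa using hH i
    · rintro _ ⟨i, -, rfl⟩
      simpa using hH (-i)
  · intro n
    obtain ⟨m, rfl | rfl⟩ := n.eq_nat_or_neg
    · simpa using Subgroup.closure_mono Set.subset_union_left (hj m)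
    · simpa using Subgroup.closure_mono Set.subset_union_right (hk m)

end MilnorRelation

/-! ### Chains of subgroups with finite-index and cyclic steps -/

section Chains

variable {G H : Type*} [Group G] [Group H]

/-- `A` is obtained from `B` by a finite-index step or by a normal step with cyclic quotient. -/
def SubgroupStep (A B : Subgroup G) : Prop :=
  (A ≤ B ∧ A.relIndex B ≠ 0) ∨
    ∃ t ∈ Subgroup.normalizer (A : Set G), B = A ⊔ Subgroup.zpowers t

/-- Groups with a finite chain of subgroups, from the trivial one to the whole group, each of finite
index in the next or normal in it with cyclic quotient. -/
def IsPolycyclicOrFinite (G : Type*) [Group G] : Prop :=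
  Relation.ReflTransGen SubgroupStep (⊥ : Subgroup G) ⊤

theorem exists_mul_zpow_of_mem_sup {A : Subgroup G} {t : G}
    (ht : t ∈ Subgroup.normalizer (A : Set G)) {x : G} (hx : x ∈ A ⊔ Subgroup.zpowers t) :
    ∃ a ∈ A, ∃ i : ℤ, x = a * t ^ i := by
  have h := Subgroup.coe_mul_of_right_le_normalizer_left A (Subgroup.zpowers t)
    (Subgroup.zpowers_le.2 ht)
  rw [← SetLike.mem_coe, h] at hx
  obtain ⟨a, ha, _, ⟨i, rfl⟩, rfl⟩ := hx
  exact ⟨a, ha, i, rfl⟩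

theorem conj_zpow_mem {A : Subgroup G} {t x : G} (ht : t ∈ Subgroup.normalizer (A : Set G))
    (hx : x ∈ A) (i : ℤ) : t ^ i * x * (t ^ i)⁻¹ ∈ A :=
  (Subgroup.mem_normalizer_iff.1 (zpow_mem ht i) x).1 hx

theorem fg_of_relIndex_ne_zero {A B : Subgroup G} (hAB : A ≤ B) (hi : A.relIndex B ≠ 0)
    (hB : B.FG) : A.FG := by
  have h1 : Group.FG B := (Group.fg_iff_subgroup_fg B).2 hB
  have h2 : (A.subgroupOf B).FiniteIndex := ⟨hi⟩
  have h3 : Group.FG (A.subgroupOf B) := inferInstance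
  exact (Group.fg_iff_subgroup_fg A).1
    (Group.fg_of_surjective (f := (Subgroup.subgroupOfEquivOfLe hAB).toMonoidHom)
      (Subgroup.subgroupOfEquivOfLe hAB).surjective)

/-- Milnor's lemma: in a group of subexponential growth, the kernel of a homomorphism from a
finitely generated subgroup to a cyclic group is finitely generated. -/
theorem LocallySubexponential.fg_of_cyclic_step (hG : LocallySubexponential G) {A : Subgroup G}
    {t : G} (ht : t ∈ Subgroup.normalizer (A : Set G)) (hB : (A ⊔ Subgroup.zpowers t).FG) :
    A.FG := by
  -- `A` is generated by the conjugates of finitely many elements and by one power of `t`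
  obtain ⟨n₀, hn₀⟩ : ∃ n₀ : ℤ, ∀ i : ℤ, t ^ i ∈ A ↔ n₀ ∣ i := by
    obtain ⟨n₀, h⟩ := Int.subgroup_cyclic (A.comap (zpowersHom G t)).toAddSubgroup'
    refine ⟨n₀, fun i => ?_⟩
    have h1 : i ∈ (A.comap (zpowersHom G t)).toAddSubgroup' ↔ t ^ i ∈ A := Iff.rfl
    rw [← h1, h, AddSubgroup.mem_closure_singleton]
    simp [dvd_iff_exists_eq_mul_left, eq_comm]
  obtain ⟨S, hS, hSfin⟩ := (Subgroup.fg_iff _).1 hB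
  have hdec : ∀ s ∈ S, ∃ a ∈ A, ∃ i : ℤ, s = a * t ^ i := fun s hs =>
    exists_mul_zpow_of_mem_sup ht (hS ▸ Subgroup.subset_closure hs)
  choose! a ha e hs using hdec
  have hU : ∀ s ∈ S, ∃ U : Set G, U.Finite ∧ U ⊆ A ∧
      ∀ n : ℤ, t ^ n * a s * (t ^ n)⁻¹ ∈ Subgroup.closure U := fun s hs =>
    hG.exists_zpow_conj_mem _ t fun n => conj_zpow_mem ht (ha s hs) n
  choose! U hUfin hUA hU using hU
  let C : Set G := {x | ∃ s ∈ S, ∃ n : ℤ, x = t ^ n * a s * (t ^ n)⁻¹} ∪ {t ^ n₀}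
  let L : Subgroup G := Subgroup.closure ((⋃ s ∈ S, U s) ∪ {t ^ n₀})
  have htn : t ^ n₀ ∈ L := Subgroup.subset_closure (Or.inr rfl)
  have hCL : Subgroup.closure C ≤ L := by
    rw [Subgroup.closure_le]
    rintro x (⟨s, hs, n, rfl⟩ | rfl)
    · refine Subgroup.closure_mono ?_ (hU s hs n)
      exact (Set.subset_biUnion_of_mem (u := U) hs).trans Set.subset_union_left
    · exact htn
  have hCt : ∀ n : ℤ, ∀ x ∈ C, t ^ n * x * (t ^ n)⁻¹ ∈ C := by
    rintro n x (⟨s, hs, m, rfl⟩ | rfl)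
    · refine Or.inl ⟨s, hs, n + m, ?_⟩
      rw [zpow_add]
      group
    · right
      simp only [Set.mem_singleton_iff]
      group
  have htC : t ∈ Subgroup.normalizer (Subgroup.closure C : Set G) := by
    refine Subgroup.normalizer_le_normalizer_closure C (Subgroup.mem_set_normalizer_iff.2 ?_)
    intro x
    refine ⟨fun hx => by simpa using hCt 1 x hx, fun hx => ?_⟩
    have := hCt (-1) _ hx
    simpa [mul_assoc] using this
  have hAL : A = L := by
    refine le_antisymm (fun x hx => ?_) ?_
    · have hx' : x ∈ Subgroup.closure S := by
        rw [hS]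
        exact Subgroup.mem_sup_left hx
      have hle : Subgroup.closure S ≤ Subgroup.closure C ⊔ Subgroup.zpowers t := by
        rw [Subgroup.closure_le]
        intro s hsS
        rw [hs s hsS]
        refine Subgroup.mul_mem_sup (Subgroup.subset_closure (Or.inl ⟨s, hsS, 0, by simp⟩)) ?_
        exact Subgroup.zpow_mem_zpowers t _
      obtain ⟨l, hl, i, rfl⟩ := exists_mul_zpow_of_mem_sup htC (hle hx')
      have hlA : l ∈ A := by
        refine (Subgroup.closure_le A).2 ?_ hl
        rintro y (⟨s, hs, n, rfl⟩ | rfl)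
        · exact conj_zpow_mem ht (ha s hs) n
        · exact (hn₀ n₀).2 dvd_rfl
      have hti : t ^ i ∈ A := (mul_mem_cancel_left hlA).1 hx
      obtain ⟨m, rfl⟩ := (hn₀ i).1 hti
      refine mul_mem (hCL hl) ?_
      rw [zpow_mul]
      exact zpow_mem htn m
    · refine (Subgroup.closure_le A).2 (Set.union_subset (Set.iUnion₂_subset hUA) ?_)
      exact Set.singleton_subset_iff.2 ((hn₀ n₀).2 dvd_rfl)
  rw [hAL]
  exact (Subgroup.fg_iff _).2 ⟨_, rfl, (hSfin.biUnion hUfin).union (Set.finite_singleton _)⟩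

theorem LocallySubexponential.fg_of_step (hG : LocallySubexponential G) {A B : Subgroup G}
    (h : SubgroupStep A B) (hB : B.FG) : A.FG := by
  rcases h with ⟨hAB, hi⟩ | ⟨t, ht, rfl⟩
  · exact fg_of_relIndex_ne_zero hAB hi hB
  · exact hG.fg_of_cyclic_step ht hB

theorem LocallySubexponential.fg_of_chain (hG : LocallySubexponential G) {A B : Subgroup G}
    (h : Relation.ReflTransGen SubgroupStep A B) (hB : B.FG) : A.FG := by
  induction h using Relation.ReflTransGen.head_induction_on with
  | refl => exact hB
  | head h _ ih => exact hG.fg_of_step h ih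

theorem SubgroupStep.comap (f : G →* H) (hf : Function.Surjective f) {A B : Subgroup H}
    (h : SubgroupStep A B) : SubgroupStep (A.comap f) (B.comap f) := by
  rcases h with ⟨hAB, hi⟩ | ⟨t, ht, rfl⟩
  · refine Or.inl ⟨Subgroup.comap_mono hAB, ?_⟩
    rwa [Subgroup.relIndex_comap, Subgroup.map_comap_eq_self_of_surjective hf]
  · obtain ⟨s, rfl⟩ := hf t
    refine Or.inr ⟨s, ?_, ?_⟩
    · rw [Subgroup.mem_normalizer_iff] at ht ⊢
      intro x
      simpa using ht (f x)
    · refine Subgroup.map_injective_of_ker_le f (f.ker_le_comap _)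
        ((f.ker_le_comap _).trans le_sup_left) ?_
      rw [Subgroup.map_sup, Subgroup.map_comap_eq_self_of_surjective hf,
        Subgroup.map_comap_eq_self_of_surjective hf, MonoidHom.map_zpowers]

theorem SubgroupStep.map (f : G →* H) (hf : Function.Injective f) {A B : Subgroup G}
    (h : SubgroupStep A B) : SubgroupStep (A.map f) (B.map f) := by
  rcases h with ⟨hAB, hi⟩ | ⟨t, ht, rfl⟩
  · refine Or.inl ⟨Subgroup.map_mono hAB, ?_⟩
    rwa [Subgroup.relIndex_map_map_of_injective _ _ hf]
  · refine Or.inr ⟨f t, Subgroup.le_normalizer_map f (Subgroup.mem_map_of_mem f ht), ?_⟩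
    rw [Subgroup.map_sup, MonoidHom.map_zpowers]

theorem IsPolycyclicOrFinite.chain_ker {f : G →* H} (hf : Function.Surjective f)
    (h : IsPolycyclicOrFinite H) : Relation.ReflTransGen SubgroupStep f.ker ⊤ := by
  have : Relation.ReflTransGen SubgroupStep ((⊥ : Subgroup H).comap f) ((⊤ : Subgroup H).comap f) :=
    Relation.ReflTransGen.lift (Subgroup.comap f) (fun _ _ => SubgroupStep.comap f hf) _ _ h
  rwa [MonoidHom.comap_bot, Subgroup.comap_top] at this

theorem IsPolycyclicOrFinite.extension {f : G →* H} (hf : Function.Surjective f)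
    (hH : IsPolycyclicOrFinite H) (hK : IsPolycyclicOrFinite f.ker) : IsPolycyclicOrFinite G := by
  have : Relation.ReflTransGen SubgroupStep ((⊥ : Subgroup f.ker).map f.ker.subtype)
      ((⊤ : Subgroup f.ker).map f.ker.subtype) :=
    Relation.ReflTransGen.lift (Subgroup.map f.ker.subtype)
      (fun _ _ => SubgroupStep.map _ f.ker.subtype_injective) _ _ hK
  rw [Subgroup.map_bot, ← MonoidHom.range_eq_map, Subgroup.range_subtype] at this
  exact Relation.ReflTransGen.trans this (hH.chain_ker hf)

theorem isPolycyclicOrFinite_of_finite [Finite G] : IsPolycyclicOrFinite G := by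
  refine .single (Or.inl ⟨bot_le, ?_⟩)
  rw [Subgroup.relIndex_top_right, Subgroup.index_bot]
  exact Nat.card_pos.ne'

theorem isPolycyclicOrFinite_of_isCyclic [IsCyclic G] : IsPolycyclicOrFinite G := by
  obtain ⟨g, hg⟩ := IsCyclic.exists_generator (α := G)
  refine .single (Or.inr ⟨g, ?_, ?_⟩)
  · rw [Subgroup.normalizer_eq_top]
    trivial
  · rw [bot_sup_eq]
    exact (Subgroup.eq_top_iff' _).2 hg |>.symm

end Chains

/-! ### Elementary amenable groups of subexponential growth -/

section ElementaryAmenable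

/-- Every finitely generated section of `G` of subexponential growth is obtained from the trivial
group by finitely many finite-index and cyclic steps. A section is given by a group `H` with a
homomorphism `i` to `G` and a surjective homomorphism `f` to the section that kills the kernel
of `i`. -/
def SubexponentialSectionsPolycyclic (G : Type u) [Group G] : Prop :=
  ∀ (H Q : Type u) [Group H] [Group Q] (i : H →* G) (f : H →* Q), Function.Surjective f →
    i.ker ≤ f.ker → Group.FG Q → LocallySubexponential Q → IsPolycyclicOrFinite Q

theorem exists_surjective_of_range {G H Q : Type*} [Group G] [Group H] [Group Q] (i : H →* G)
    (f : H →* Q) (hf : Function.Surjective f) (h : i.ker ≤ f.ker) :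
    ∃ g : i.range →* Q, Function.Surjective g := by
  refine ⟨i.rangeRestrict.liftOfSurjective i.rangeRestrict_surjective
    ⟨f, by rwa [MonoidHom.ker_rangeRestrict]⟩, fun q => ?_⟩
  obtain ⟨x, rfl⟩ := hf q
  exact ⟨i.rangeRestrict x, MonoidHom.liftOfRightInverse_comp_apply _ _ _ _ x⟩

variable {G : Type u} [Group G]

theorem SubexponentialSectionsPolycyclic.of_hom {G' : Type u} [Group G']
    (h : SubexponentialSectionsPolycyclic G') (j : G →* G') (hj : Function.Injective j) :
    SubexponentialSectionsPolycyclic G := by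
  intro H Q _ _ i f hf hi hfg hsub
  refine h H Q (j.comp i) f hf (fun x hx => hi ?_) hfg hsub
  exact hj (by simpa using hx)

theorem SubexponentialSectionsPolycyclic.of_surjective {G' : Type u} [Group G']
    (h : SubexponentialSectionsPolycyclic G) (j : G →* G') (hj : Function.Surjective j) :
    SubexponentialSectionsPolycyclic G' := by
  intro H Q _ _ i f hf hi hfg hsub
  let P : Subgroup (H × G) := (i.comp (MonoidHom.fst H G)).eqLocus (j.comp (MonoidHom.snd H G))
  refine h P Q ((MonoidHom.snd H G).comp P.subtype) (f.comp ((MonoidHom.fst H G).comp P.subtype))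
    ?_ ?_ hfg hsub
  · intro q
    obtain ⟨x, rfl⟩ := hf q
    obtain ⟨g, hg⟩ := hj (i x)
    exact ⟨⟨(x, g), hg.symm⟩, rfl⟩
  · rintro ⟨⟨x, g⟩, hxg⟩ hg
    have hg' : g = 1 := hg
    have hxg' : i x = j g := hxg
    have : x ∈ i.ker := by rw [MonoidHom.mem_ker, hxg', hg', map_one]
    exact hi this

theorem SubexponentialSectionsPolycyclic.extension (N : Subgroup G) [N.Normal]
    (hN : SubexponentialSectionsPolycyclic N) (hQ : SubexponentialSectionsPolycyclic (G ⧸ N)) :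
    SubexponentialSectionsPolycyclic G := by
  intro H Q _ _ i f hf hi hfg hsub
  let i' : H →* G ⧸ N := (QuotientGroup.mk' N).comp i
  have : (i'.ker.map f).Normal := Subgroup.Normal.map inferInstance f hf
  let π : Q →* Q ⧸ i'.ker.map f := QuotientGroup.mk' _
  have hπ : Function.Surjective π := QuotientGroup.mk'_surjective _
  have hker : π.ker = i'.ker.map f := QuotientGroup.ker_mk' _
  have hquot : IsPolycyclicOrFinite (Q ⧸ i'.ker.map f) := by
    refine hQ H _ i' (π.comp f) (hπ.comp hf) ?_ (Group.fg_of_surjective hπ)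
      (hsub.of_surjective π hπ)
    intro x hx
    have : f x ∈ π.ker := hker.ge (Subgroup.mem_map_of_mem f hx)
    exact this
  have hkfg : Group.FG π.ker := (Group.fg_iff_subgroup_fg _).2
    (hsub.fg_of_chain (hquot.chain_ker hπ) (Group.fg_def.1 hfg))
  refine hquot.extension hπ ?_
  have hmem : ∀ x : i'.ker, i x ∈ N := fun x => by
    have := x.2
    rwa [MonoidHom.mem_ker, MonoidHom.comp_apply, QuotientGroup.mk'_apply,
      QuotientGroup.eq_one_iff] at this
  have hmem' : ∀ x : i'.ker, f x ∈ π.ker := fun x => hker.ge (Subgroup.mem_map_of_mem f x.2)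
  refine hN i'.ker π.ker ((i.comp i'.ker.subtype).codRestrict N hmem)
    ((f.comp i'.ker.subtype).codRestrict π.ker hmem') ?_ ?_ hkfg
    (hsub.of_injective _ π.ker.subtype_injective)
  · rintro ⟨q, hq⟩
    rw [hker] at hq
    obtain ⟨x, hx, rfl⟩ := hq
    exact ⟨⟨x, hx⟩, rfl⟩
  · intro x hx
    have h1 : i x = 1 := congrArg Subtype.val hx
    have h2 : f x = 1 := hi h1
    exact Subtype.ext h2

theorem exists_mem_of_directedOn {S : Set (Subgroup G)} (hne : S.Nonempty)
    (hdir : DirectedOn (fun H K => H ≤ K) S) (hunion : ∀ g : G, ∃ H ∈ S, g ∈ H) {T : Set G}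
    (hT : T.Finite) : ∃ L ∈ S, T ⊆ (L : Set G) := by
  induction T, hT using Set.Finite.induction_on with
  | empty =>
    obtain ⟨L, hL⟩ := hne
    exact ⟨L, hL, Set.empty_subset _⟩
  | @insert a T _ _ ih =>
    obtain ⟨L, hL, hTL⟩ := ih
    obtain ⟨M, hM, haM⟩ := hunion a
    obtain ⟨K, hK, hLK, hMK⟩ := hdir L hL M hM
    exact ⟨K, hK, Set.insert_subset (hMK haM) (hTL.trans hLK)⟩

theorem SubexponentialSectionsPolycyclic.directedUnion {S : Set (Subgroup G)} (hne : S.Nonempty)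
    (hdir : DirectedOn (fun H K => H ≤ K) S) (hunion : ∀ g : G, ∃ H ∈ S, g ∈ H)
    (h : ∀ H ∈ S, SubexponentialSectionsPolycyclic H) : SubexponentialSectionsPolycyclic G := by
  intro H Q _ _ i f hf hi hfg hsub
  obtain ⟨F, hF, hFfin⟩ := Group.fg_iff.1 hfg
  let T : Set H := Function.surjInv hf '' F
  obtain ⟨L, hL, hTL⟩ := exists_mem_of_directedOn hne hdir hunion
    ((hFfin.image _).image i : (i '' T).Finite)
  have hmem : ∀ x : Subgroup.closure T, i x ∈ L := by
    have : Subgroup.closure T ≤ L.comap i := by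
      rw [Subgroup.closure_le]
      intro x hx
      exact hTL ⟨x, hx, rfl⟩
    exact fun x => this x.2
  refine h L hL (Subgroup.closure T) Q ((i.comp (Subgroup.closure T).subtype).codRestrict L hmem)
    (f.comp (Subgroup.closure T).subtype) ?_ ?_ hfg hsub
  · rw [← MonoidHom.range_eq_top, eq_top_iff, ← hF, Subgroup.closure_le]
    intro q hq
    exact ⟨⟨Function.surjInv hf q, Subgroup.subset_closure ⟨q, hq, rfl⟩⟩, Function.surjInv_eq hf q⟩
  · intro x hx
    exact hi (congrArg Subtype.val hx)

/-- Induction over the construction of elementary amenable groups. -/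
theorem IsElementaryAmenable.subexponentialSectionsPolycyclic (h : IsElementaryAmenable G) :
    SubexponentialSectionsPolycyclic G := by
  induction h with
  | ofInt G e =>
    intro H Q _ _ i f hf hi _ _
    have : IsCyclic G := isCyclic_of_surjective e e.surjective
    obtain ⟨g, hg⟩ := exists_surjective_of_range i f hf hi
    have : IsCyclic Q := isCyclic_of_surjective g hg
    exact isPolycyclicOrFinite_of_isCyclic
  | ofFinite G h =>
    intro H Q _ _ i f hf hi _ _
    obtain ⟨g, hg⟩ := exists_surjective_of_range i f hf hi
    have : Finite Q := Finite.of_surjective g hg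
    exact isPolycyclicOrFinite_of_finite
  | ofIso G G' e _ ih => exact ih.of_surjective e.toMonoidHom e.surjective
  | subgroup G H _ ih => exact ih.of_hom H.subtype H.subtype_injective
  | quotient G N _ ih => exact ih.of_surjective (QuotientGroup.mk' N) (QuotientGroup.mk'_surjective N)
  | extension G N _ _ ihN ihQ => exact .extension N ihN ihQ
  | directedUnion G S hne hdir hunion _ ih => exact .directedUnion hne hdir hunion ih

theorem IsElementaryAmenable.isPolycyclicOrFinite (h : IsElementaryAmenable G) (hfg : Group.FG G)
    (hG : LocallySubexponential G) : IsPolycyclicOrFinite G :=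
  h.subexponentialSectionsPolycyclic G G (MonoidHom.id G) (MonoidHom.id G) Function.surjective_id
    le_rfl hfg hG

end ElementaryAmenable

/-! ### Automorphisms of finitely generated abelian groups -/

section QuasiUnipotent

open Polynomial

theorem Polynomial.prod_X_sub_C_dvd_pow {s : Multiset ℂ} {k : ℕ} (h : ∀ a ∈ s, a ^ k = 1) :
    (s.map fun a => X - C a).prod ∣ (X ^ k - 1 : ℂ[X]) ^ s.card := by
  induction s using Multiset.induction_on with
  | empty => simp
  | cons a s ih =>
    rw [Multiset.map_cons, Multiset.prod_cons, Multiset.card_cons, pow_succ']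
    refine mul_dvd_mul ?_ (ih fun b hb => h b (Multiset.mem_cons_of_mem hb))
    rw [dvd_iff_isRoot]
    simp [h a (Multiset.mem_cons_self a s)]

/-- An invertible integer matrix whose complex eigenvalues lie in the closed unit disc has a
unipotent power, because by Kronecker's theorem its eigenvalues are roots of unity. -/
theorem Matrix.exists_pow_sub_one_pow_eq_zero {ι : Type*} [Fintype ι] [DecidableEq ι]
    (A : Matrix ι ι ℤ) (hdet : A.det ≠ 0)
    (hroot : ∀ z ∈ (A.charpoly.map (Int.castRingHom ℂ)).roots, ‖z‖ ≤ 1) :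
    ∃ k m : ℕ, 0 < k ∧ (A ^ k - 1) ^ m = 0 := by
  set p : ℂ[X] := A.charpoly.map (Int.castRingHom ℂ) with hp
  have hmonic : p.Monic := A.charpoly_monic.map _
  have hmahler : p.mahlerMeasure = 1 := by
    rw [mahlerMeasure_eq_leadingCoeff_mul_prod_roots, hmonic.leadingCoeff, norm_one, one_mul]
    refine Multiset.prod_eq_one fun x hx => ?_
    obtain ⟨z, hz, rfl⟩ := Multiset.mem_map.1 hx
    exact max_eq_left (hroot z hz)
  have hunit : ∀ z ∈ p.roots, ∃ n, 0 < n ∧ z ^ n = 1 := by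
    intro z hz
    refine pow_eq_one_of_mahlerMeasure_eq_one hmahler ?_ hz
    rintro rfl
    have h0 := isRoot_of_mem_roots hz
    rw [IsRoot.def, ← coeff_zero_eq_eval_zero, hp, coeff_map,
      map_eq_zero_iff _ (Int.castRingHom ℂ).injective_int] at h0
    rw [A.det_eq_sign_charpoly_coeff, h0, mul_zero] at hdet
    exact hdet rfl
  choose! n hnpos hn using hunit
  refine ⟨∏ z ∈ p.roots.toFinset, n z, p.roots.card, ?_, ?_⟩
  · exact Finset.prod_pos fun z hz => hnpos z (Multiset.mem_toFinset.1 hz)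
  set k := ∏ z ∈ p.roots.toFinset, n z
  have hk : ∀ z ∈ p.roots, z ^ k = 1 := by
    intro z hz
    obtain ⟨c, hc⟩ := Finset.dvd_prod_of_mem n (Multiset.mem_toFinset.2 hz)
    rw [show k = n z * c from hc, pow_mul, hn z hz, one_pow]
  have hdvd : p ∣ (X ^ k - 1) ^ p.roots.card := by
    conv_lhs => rw [(IsAlgClosed.splits p).eq_prod_roots_of_monic hmonic]
    exact Polynomial.prod_X_sub_C_dvd_pow hk
  have hA : aeval (A.map (Int.castRingHom ℂ)) p = 0 := by
    rw [hp, ← Matrix.charpoly_map]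
    exact Matrix.aeval_self_charpoly _
  have h1 : (A.map (Int.castRingHom ℂ) ^ k - 1) ^ p.roots.card = 0 := by
    obtain ⟨q, hq⟩ := hdvd
    have := congrArg (aeval (A.map (Int.castRingHom ℂ))) hq
    rw [map_mul, hA, zero_mul] at this
    simpa using this
  have hinj : Function.Injective ((Int.castRingHom ℂ).mapMatrix (m := ι)) :=
    Matrix.map_injective Int.cast_injective
  refine hinj ?_
  rw [map_pow, map_sub, map_pow, map_one, map_zero]
  exact h1

/-- An automorphism of a finitely generated abelian group has a unipotent power as soon as its
eigenvalues on the complex-valued characters of the group lie in the closed unit disc. -/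
theorem LinearEquiv.exists_pow_sub_one_pow_eq_zero {M : Type*} [AddCommGroup M]
    [Module.Finite ℤ M] (φ : M ≃ₗ[ℤ] M)
    (h : ∀ (l : M →ₗ[ℤ] ℂ) (z : ℂ), l ≠ 0 → (∀ x, l (φ x) = z * l x) → ‖z‖ ≤ 1) :
    ∃ k m : ℕ, 0 < k ∧ ((φ : Module.End ℤ M) ^ k - 1) ^ m = 0 := by
  let T := Submodule.torsion ℤ M
  let φ' : Module.End ℤ M := φ
  have hTφ : ∀ ψ : M ≃ₗ[ℤ] M, ∀ x ∈ T, ψ x ∈ T := by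
    rintro ψ x ⟨a, ha⟩
    exact ⟨a, by rw [← map_zero ψ, ← ha]; exact (map_zsmul ψ (a : ℤ) x).symm⟩
  have hTmap : T.map (φ : M →ₗ[ℤ] M) = T := by
    refine le_antisymm (Submodule.map_le_iff_le_comap.2 fun x hx => hTφ φ x hx) fun x hx => ?_
    exact ⟨φ.symm x, hTφ φ.symm x hx, φ.apply_symm_apply x⟩
  let F := M ⧸ T
  let φF : F ≃ₗ[ℤ] F := Submodule.Quotient.equiv T T φ hTmap
  let b := Module.Free.chooseBasis ℤ F
  let A := LinearMap.toMatrix b b (φF : F →ₗ[ℤ] F)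
  have hdet : A.det ≠ 0 := by
    rw [LinearMap.det_toMatrix]
    exact (LinearEquiv.isUnit_det' φF).ne_zero
  have hroot : ∀ z ∈ (A.charpoly.map (Int.castRingHom ℂ)).roots, ‖z‖ ≤ 1 := by
    intro z hz
    have hz0 := isRoot_of_mem_roots hz
    rw [← Matrix.charpoly_map, IsRoot.def, Matrix.eval_charpoly,
      ← Matrix.exists_vecMul_eq_zero_iff] at hz0
    obtain ⟨v, hv, hvA⟩ := hz0
    rw [Matrix.vecMul_sub, sub_eq_zero] at hvA
    have hvA' : ∀ j, ∑ i, v i * (A i j : ℂ) = z * v j := by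
      intro j
      have := congrFun hvA j
      simp only [Matrix.scalar_apply, Matrix.vecMul_diagonal] at this
      rw [mul_comm z, this]
      simp [Matrix.vecMul, dotProduct]
    let l' : F →ₗ[ℤ] ℂ := b.constr ℤ v
    refine h (l'.comp T.mkQ) z ?_ ?_
    · intro h0
      refine hv (funext fun i => ?_)
      obtain ⟨x, hx⟩ := T.mkQ_surjective (b i)
      have := LinearMap.congr_fun h0 x
      rw [LinearMap.comp_apply, hx] at this
      simpa [l'] using this
    · have hl : l' ∘ₗ (φF : F →ₗ[ℤ] F) = (LinearMap.mulLeft ℤ z) ∘ₗ l' := by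
        refine b.ext fun j => ?_
        have hj : (φF : F →ₗ[ℤ] F) (b j) = ∑ i, A i j • b i := by
          simp only [A, LinearMap.toMatrix_apply]
          exact (b.sum_repr _).symm
        rw [LinearMap.comp_apply, hj, map_sum, LinearMap.comp_apply, LinearMap.mulLeft_apply]
        simp only [map_zsmul, l', Module.Basis.constr_basis]
        rw [← hvA' j]
        refine Finset.sum_congr rfl fun i _ => ?_
        rw [zsmul_eq_mul, mul_comm]
      intro x
      exact LinearMap.congr_fun hl (T.mkQ x)
  obtain ⟨k, m, hk, hkm⟩ := A.exists_pow_sub_one_pow_eq_zero hdet hroot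
  have hF : ((φF : Module.End ℤ F) ^ k - 1) ^ m = 0 := by
    refine (LinearMap.toMatrixAlgEquiv b).injective ?_
    rw [map_pow, map_sub, map_pow, map_one, map_zero]
    exact hkm
  have hTm : ∀ x, ((φ' ^ k - 1) ^ m) x ∈ T := by
    have hcomm : ∀ (ψ : Module.End ℤ M) (ψF : Module.End ℤ F),
        (∀ x, T.mkQ (ψ x) = ψF (T.mkQ x)) → ∀ (n : ℕ) x, T.mkQ ((ψ ^ n) x) = (ψF ^ n) (T.mkQ x) := by
      intro ψ ψF hψ n
      induction n with
      | zero => intro x; rfl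
      | succ n ih =>
        intro x
        rw [pow_succ, pow_succ, Module.End.mul_apply, Module.End.mul_apply, ih, hψ]
    have h1 := hcomm φ' (φF : Module.End ℤ F) (fun x => rfl) k
    have h2 := hcomm (φ' ^ k - 1) ((φF : Module.End ℤ F) ^ k - 1)
      (fun x => by simp only [LinearMap.sub_apply, map_sub, h1, Module.End.one_apply]) m
    intro x
    have := h2 x
    rw [hF, LinearMap.zero_apply] at this
    exact (Submodule.Quotient.mk_eq_zero T).1 this
  have hTfin : Finite T := by
    have : Module.IsTorsion ℤ T := Submodule.torsion_isTorsion
    exact Module.finite_of_fg_torsion T this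
  -- some power of `φ` is the identity on the finite torsion subgroup
  obtain ⟨k', hk', hTk⟩ : ∃ k', 0 < k' ∧ ∀ x ∈ T, (φ' ^ k') x = x := by
    let σ : Equiv.Perm T :=
      { toFun := fun x => ⟨φ x, hTφ φ x x.2⟩
        invFun := fun x => ⟨φ.symm x, hTφ φ.symm x x.2⟩
        left_inv := fun x => Subtype.ext (φ.symm_apply_apply x)
        right_inv := fun x => Subtype.ext (φ.apply_symm_apply x) }
    have hσ : ∀ (n : ℕ) (x : T), ((σ ^ n) x : M) = (φ' ^ n) x := by
      intro n
      induction n with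
      | zero => intro x; rfl
      | succ n ih =>
        intro x
        rw [pow_succ, pow_succ, Equiv.Perm.mul_apply, Module.End.mul_apply, ih]
        rfl
    refine ⟨orderOf σ, orderOf_pos σ, fun x hx => ?_⟩
    rw [← hσ (orderOf σ) ⟨x, hx⟩, pow_orderOf_eq_one]
    rfl
  refine ⟨k * k', m + 1, Nat.mul_pos hk hk', ?_⟩
  change (φ' ^ (k * k') - 1) ^ (m + 1) = 0
  have hfix : ∀ x ∈ T, (φ' ^ (k * k') - 1) x = 0 := by
    intro x hx
    have : ∀ n : ℕ, ((φ' ^ k') ^ n) x = x := by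
      intro n
      induction n with
      | zero => rfl
      | succ n ih => rw [pow_succ, Module.End.mul_apply, hTk x hx, ih]
    rw [LinearMap.sub_apply, mul_comm k, pow_mul, this, Module.End.one_apply, sub_self]
  obtain ⟨q, hq⟩ : ∃ q : Module.End ℤ M, φ' ^ (k * k') - 1 = (φ' ^ k - 1) * q ∧
      Commute (φ' ^ k - 1) q := by
    have hd : (X ^ k - 1 : ℤ[X]) ∣ X ^ (k * k') - 1 := by
      simpa [pow_mul] using sub_dvd_pow_sub_pow (X ^ k : ℤ[X]) 1 k'
    obtain ⟨r, hr⟩ := hd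
    have e : aeval φ' (X ^ k - 1 : ℤ[X]) = φ' ^ k - 1 := by simp
    refine ⟨aeval φ' r, ?_, ?_⟩
    · simpa using congrArg (aeval φ') hr
    · rw [← e, commute_iff_eq, ← map_mul, ← map_mul, mul_comm]
  ext x
  rw [pow_succ', Module.End.mul_apply]
  refine hfix _ ?_
  rw [hq.1, hq.2.mul_pow, Module.End.mul_apply]
  exact hTm _

end QuasiUnipotent

section Eigenvalues

variable {G : Type*} [Group G]

/-- The value at `z` of the polynomial with coefficients `0` and `1` given by a list. -/
def boolEval (z : ℂ) : List Bool → ℂ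
  | [] => 0
  | b :: l => (if b then 1 else 0) + z * boolEval z l

theorem norm_boolEval_sub_le {z : ℂ} (hz : 2 ≤ ‖z‖) (p q : List Bool) (h : p.length = q.length) :
    ‖boolEval z p - boolEval z q‖ ≤ ‖z‖ ^ p.length - 1 := by
  induction p generalizing q with
  | nil =>
    rw [List.length_eq_zero_iff.1 (h.symm.trans List.length_nil)]
    simp
  | cons b p ih =>
    cases q with
    | nil => simp at h
    | cons c q =>
      have h1 := ih q (by simpa using h)
      have h2 : ‖((if b then 1 else 0) - (if c then 1 else 0) : ℂ)‖ ≤ 1 := by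
        cases b <;> cases c <;> simp
      have e : boolEval z (b :: p) - boolEval z (c :: q) =
          ((if b then 1 else 0) - (if c then 1 else 0)) + z * (boolEval z p - boolEval z q) := by
        simp only [boolEval]
        ring
      rw [e, List.length_cons]
      refine (norm_add_le _ _).trans ?_
      rw [norm_mul, pow_succ']
      nlinarith [mul_le_mul_of_nonneg_left h1 (norm_nonneg z)]

/-- If `t` acts by conjugation with the eigenvalue `z` on a nonzero additive character of a subgroup
of a group of subexponential growth, then `|z| ≤ 1`: otherwise the relation between the conjugates
of an element by the powers of a power of `t` is violated. -/
theorem LocallySubexponential.norm_eigenvalue_le_one (hG : LocallySubexponential G)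
    {D : Subgroup G} {t : G} (ht : t ∈ Subgroup.normalizer (D : Set G)) {l : G → ℂ} {z : ℂ}
    (hl : ∀ x ∈ D, ∀ y ∈ D, l (x * y) = l x + l y) (hlt : ∀ x ∈ D, l (t * x * t⁻¹) = z * l x)
    {h : G} (hh : h ∈ D) (hlh : l h ≠ 0) : ‖z‖ ≤ 1 := by
  by_contra! hz
  obtain ⟨k, hk⟩ := pow_unbounded_of_one_lt 2 hz
  have htk : ∀ i : ℕ, ∀ x ∈ D, t ^ i * x * (t ^ i)⁻¹ ∈ D := fun i x hx => by
    simpa using conj_zpow_mem ht hx i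
  have hlk : ∀ i : ℕ, ∀ x ∈ D, l (t ^ i * x * (t ^ i)⁻¹) = z ^ i * l x := by
    intro i x hx
    induction i with
    | zero => simp
    | succ i ih =>
      have e : t ^ (i + 1) * x * (t ^ (i + 1))⁻¹ = t * (t ^ i * x * (t ^ i)⁻¹) * t⁻¹ := by
        rw [pow_succ']
        group
      rw [e, hlt _ (htk i x hx), ih, pow_succ']
      ring
  have hl1 : l 1 = 0 := by
    have := hl 1 (one_mem D) 1 (one_mem D)
    simpa using this
  have hprod : ∀ p : List Bool, conjProd h (t ^ k) p ∈ D ∧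
      l (conjProd h (t ^ k) p) = boolEval (z ^ k) p * l h := by
    intro p
    induction p with
    | nil => simp [conjProd, boolEval, hl1]
    | cons b p ih =>
      have hb : (if b then h else 1) ∈ D := by
        cases b
        · simp
        · simpa using hh
      have hlb : l (if b then h else 1) = (if b then 1 else 0) * l h := by
        cases b <;> simp [hl1]
      refine ⟨mul_mem hb (htk k _ ih.1), ?_⟩
      rw [conjProd, hl _ hb _ (htk k _ ih.1), hlk k _ ih.1, ih.2, hlb, boolEval]
      ring
  obtain ⟨p, q, hpq, he⟩ := hG.exists_conjProd_eq h (t ^ k)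
  have h1 := congrArg l he
  rw [← pow_mul, hl _ (hprod p).1 _ (htk _ h hh), hlk _ h hh, (hprod p).2, (hprod q).2, ← add_mul,
    pow_mul] at h1
  have h2 := mul_right_cancel₀ hlh h1
  have h3 : boolEval (z ^ k) q - boolEval (z ^ k) p = (z ^ k) ^ p.length := by
    rw [← h2]
    ring
  have h4 := norm_boolEval_sub_le (z := z ^ k) (by rw [norm_pow]; exact hk.le) q p hpq.symm
  rw [h3, norm_pow, hpq] at h4
  linarith

end Eigenvalues

/-! ### Polynomial growth of polycyclic groups of subexponential growth -/

section FiniteIndex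

variable {G : Type*} [Group G]

theorem relIndex_ne_zero_iff_exists_finite {A B : Subgroup G} :
    A.relIndex B ≠ 0 ↔ ∃ R : Set G, R.Finite ∧ R ⊆ B ∧ ∀ b ∈ B, ∃ r ∈ R, r⁻¹ * b ∈ A := by
  constructor
  · intro h
    have : (A.subgroupOf B).FiniteIndex := ⟨h⟩
    refine ⟨Set.range fun q : B ⧸ A.subgroupOf B => (q.out : G), Set.finite_range _, ?_, ?_⟩
    · rintro _ ⟨q, rfl⟩
      exact q.out.2
    · intro b hb
      refine ⟨_, ⟨QuotientGroup.mk ⟨b, hb⟩, rfl⟩, ?_⟩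
      have h1 : (QuotientGroup.mk (QuotientGroup.mk (s := A.subgroupOf B) ⟨b, hb⟩).out :
          B ⧸ A.subgroupOf B) = QuotientGroup.mk ⟨b, hb⟩ := Quotient.out_eq' _
      have h2 := QuotientGroup.eq.1 h1
      exact h2
  · rintro ⟨R, hR, hRB, h⟩
    have := hR.to_subtype
    let f : R → B ⧸ A.subgroupOf B := fun r => QuotientGroup.mk ⟨r, hRB r.2⟩
    have hf : Function.Surjective f := by
      intro q
      induction q using QuotientGroup.induction_on with
      | H b =>
        obtain ⟨r, hr, hrb⟩ := h b b.2
        exact ⟨⟨r, hr⟩, QuotientGroup.eq.2 hrb⟩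
    have : Finite (B ⧸ A.subgroupOf B) := Finite.of_surjective f hf
    exact (Subgroup.finiteIndex_of_finite_quotient (H := A.subgroupOf B)).index_ne_zero

/-- All finitely generated subgroups of `A` have polynomial growth. -/
def LocallyPolynomial (A : Subgroup G) : Prop :=
  ∀ S : Set G, S.Finite → S ⊆ A → PolynomiallyBounded (groupGrowth S)

theorem LocallyPolynomial.of_relIndex_ne_zero {A B : Subgroup G} (hi : A.relIndex B ≠ 0)
    (hA : LocallyPolynomial A) : LocallyPolynomial B := by
  intro S hS hSB
  obtain ⟨R, hR, hRB, hcov⟩ := relIndex_ne_zero_iff_exists_finite.1 hi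
  let S₁ : Set G := {1} ∪ S ∪ S⁻¹
  have hS₁ : S₁.Finite := ((Set.finite_singleton 1).union hS).union hS.inv
  have hS₁B : S₁ ⊆ B := by
    rw [show S₁ = wordBall S 1 from (wordBall_one S).symm]
    exact (wordBall_subset_closure S 1).trans ((Subgroup.closure_le B).2 hSB)
  -- the elements `r⁻¹ * s * r'` of `A` are Schreier generators
  let U : Set G := Set.image2 (fun p r' => p.1⁻¹ * p.2 * r') (R ×ˢ S₁) R ∩ A
  have hU : U.Finite := ((hR.prod hS₁).image2 _ hR).inter_of_left _
  have hball : ∀ n : ℕ, ∀ x ∈ wordBall S n, ∀ r ∈ R, ∃ r' ∈ R, r'⁻¹ * (x * r) ∈ wordBall U n := by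
    intro n
    induction n with
    | zero =>
      intro x hx r hr
      rw [wordBall_zero] at hx
      rw [Set.mem_singleton_iff.1 hx]
      exact ⟨r, hr, by simpa using one_mem_wordBall U 0⟩
    | succ n ih =>
      intro x hx r hr
      rw [add_comm, wordBall_add, wordBall_one] at hx
      obtain ⟨s, hs, y, hy, rfl⟩ := hx
      obtain ⟨r₁, hr₁, h₁⟩ := ih y hy r hr
      obtain ⟨r', hr', h'⟩ := hcov (s * r₁) (mul_mem (hS₁B hs) (hRB hr₁))
      refine ⟨r', hr', ?_⟩
      have e : r'⁻¹ * (s * y * r) = (r'⁻¹ * (s * r₁)) * (r₁⁻¹ * (y * r)) := by group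
      change r'⁻¹ * (s * y * r) ∈ _
      rw [e, add_comm]
      refine mul_mem_wordBall (subset_wordBall_one U ⟨⟨(r', s), ⟨hr', hs⟩, r₁, hr₁, ?_⟩, h'⟩) h₁
      simp [mul_assoc]
  obtain ⟨r₀, hr₀, -⟩ := hcov 1 (one_mem B)
  refine ((hA U hU Set.inter_subset_right).mul
    (⟨R.ncard, 0, fun _ => by simp⟩ : PolynomiallyBounded fun _ => R.ncard)).mono fun n => ?_
  have hsub : wordBall S n ⊆ Set.image2 (fun u r => r * u * r₀⁻¹) (wordBall U n) R := by
    intro x hx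
    obtain ⟨r, hr, h⟩ := hball n x hx r₀ hr₀
    exact ⟨_, h, r, hr, by group⟩
  refine (Set.ncard_le_ncard hsub ((wordBall_finite hU n).image2 _ hR)).trans ?_
  rw [← Set.image_prod]
  refine (Set.ncard_image_le ((wordBall_finite hU n).prod hR)).trans ?_
  rw [Set.ncard_prod]
  rfl

end FiniteIndex

section Tame

variable {G : Type*} [Group G] {A : Subgroup G} {t : G}

/-- The elements of `G` whose conjugates by `t ^ j` have a word length in `A` that is bounded by a
polynomial in `j`. -/
def tameSubgroup (A : Subgroup G) (t : G) : Subgroup G where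
  carrier := {x | ∃ U : Set G, U.Finite ∧ U ⊆ A ∧ ∃ C d : ℕ, ∀ j : ℕ,
    t ^ j * x * (t ^ j)⁻¹ ∈ wordBall U (C * (j + 1) ^ d)}
  one_mem' := ⟨∅, Set.finite_empty, Set.empty_subset _, 0, 0, fun j => by
    simpa using one_mem_wordBall _ _⟩
  mul_mem' := by
    rintro x y ⟨U, hU, hUA, C, d, h⟩ ⟨U', hU', hUA', C', d', h'⟩
    refine ⟨U ∪ U', hU.union hU', Set.union_subset hUA hUA', C + C', d + d', fun j => ?_⟩
    have e : t ^ j * (x * y) * (t ^ j)⁻¹ =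
        (t ^ j * x * (t ^ j)⁻¹) * (t ^ j * y * (t ^ j)⁻¹) := by group
    rw [e]
    refine wordBall_mono_right _ ?_ (mul_mem_wordBall
      (wordBall_mono_left Set.subset_union_left _ (h j))
      (wordBall_mono_left Set.subset_union_right _ (h' j)))
    rw [add_mul]
    gcongr <;> omega
  inv_mem' := by
    rintro x ⟨U, hU, hUA, C, d, h⟩
    refine ⟨U, hU, hUA, C, d, fun j => ?_⟩
    have e : t ^ j * x⁻¹ * (t ^ j)⁻¹ = (t ^ j * x * (t ^ j)⁻¹)⁻¹ := by group
    rw [e]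
    exact inv_mem_wordBall (h j)

/-- One step of unipotence: the conjugates of `x` are partial products of the conjugates of
`x⁻¹ * (t * x * t⁻¹)`. -/
theorem mem_tameSubgroup_of_commutator {x : G} (hx : x ∈ A)
    (h : x⁻¹ * (t * x * t⁻¹) ∈ tameSubgroup A t) : x ∈ tameSubgroup A t := by
  obtain ⟨U, hU, hUA, C, d, h⟩ := h
  refine ⟨insert x U, hU.insert x, Set.insert_subset hx hUA, C + 1, d + 1, fun j => ?_⟩
  have key : ∀ j : ℕ, t ^ j * x * (t ^ j)⁻¹ ∈ wordBall (insert x U) (1 + j * (C * (j + 1) ^ d)) := by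
    intro j
    induction j with
    | zero =>
      refine wordBall_mono_right _ (Nat.le_add_right 1 _) (subset_wordBall_one _ ?_)
      simp
    | succ j ih =>
      have e : t ^ (j + 1) * x * (t ^ (j + 1))⁻¹ =
          (t ^ j * x * (t ^ j)⁻¹) * (t ^ j * (x⁻¹ * (t * x * t⁻¹)) * (t ^ j)⁻¹) := by
        rw [pow_succ]
        group
      rw [e]
      refine wordBall_mono_right _ ?_ (mul_mem_wordBall ih
        (wordBall_mono_left (Set.subset_insert x U) _ (h j)))
      have : C * (j + 1) ^ d ≤ C * (j + 1 + 1) ^ d := by gcongr; omega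
      nlinarith
  refine wordBall_mono_right _ ?_ (key j)
  have h1 : 1 ≤ (j + 1) ^ (d + 1) := Nat.one_le_pow _ _ (by omega)
  have h2 : j * (C * (j + 1) ^ d) ≤ C * (j + 1) ^ (d + 1) := by
    rw [pow_succ]
    nlinarith [Nat.zero_le (C * (j + 1) ^ d)]
  linarith

theorem tameSubgroup_pow_le (ht : t ∈ Subgroup.normalizer (A : Set G)) {k : ℕ} (hk : 0 < k) :
    tameSubgroup A (t ^ k) ≤ tameSubgroup A t := by
  rintro x ⟨U, hU, hUA, C, d, h⟩
  refine ⟨⋃ r ∈ Finset.range k, MulAut.conj (t ^ r) '' U,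
    Set.Finite.biUnion (Finset.finite_toSet _) fun r _ => hU.image _, ?_, C, d, fun j => ?_⟩
  · refine Set.iUnion₂_subset fun r _ => ?_
    rintro _ ⟨u, hu, rfl⟩
    change t ^ r * u * (t ^ r)⁻¹ ∈ A
    simpa using conj_zpow_mem ht (hUA hu) r
  · have h1 : t ^ j * x * (t ^ j)⁻¹ =
        MulAut.conj (t ^ (j % k)) ((t ^ k) ^ (j / k) * x * ((t ^ k) ^ (j / k))⁻¹) := by
      rw [MulAut.conj_apply]
      conv_lhs => rw [← Nat.mod_add_div j k, pow_add, pow_mul]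
      group
    have h2 := Set.mem_image_of_mem (MulAut.conj (t ^ (j % k))).toMonoidHom (h (j / k))
    rw [image_wordBall] at h2
    rw [h1]
    refine wordBall_mono_right _ ?_ (wordBall_mono_left ?_ _ h2)
    · gcongr
      exact Nat.div_le_self j k
    · exact Set.subset_biUnion_of_mem (u := fun r => MulAut.conj (t ^ r) '' U)
        (Finset.mem_coe.2 (Finset.mem_range.2 (Nat.mod_lt j hk)))

theorem mem_normalizer_of_conj_mem {A : Subgroup G} {t : G} (h : ∀ x ∈ A, t * x * t⁻¹ ∈ A)
    (h' : ∀ x ∈ A, t⁻¹ * x * t ∈ A) : t ∈ Subgroup.normalizer (A : Set G) := by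
  rw [Subgroup.mem_normalizer_iff]
  refine fun x => ⟨h x, fun hx => ?_⟩
  have := h' _ hx
  rwa [show t⁻¹ * (t * x * t⁻¹) * t = x by group] at this

/-- Conjugation by a normalizing element, as an automorphism of the subgroup. -/
def normalizerConj {A : Subgroup G} {t : G} (ht : t ∈ Subgroup.normalizer (A : Set G)) :
    A ≃* A where
  toFun x := ⟨t * x * t⁻¹, (Subgroup.mem_normalizer_iff.1 ht x).1 x.2⟩
  invFun x := ⟨t⁻¹ * x * t, (Subgroup.mem_normalizer_iff''.1 ht x).1 x.2⟩
  left_inv x := Subtype.ext (by simp [mul_assoc])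
  right_inv x := Subtype.ext (by simp [mul_assoc])
  map_mul' x y := Subtype.ext (by simp [mul_assoc])

theorem normalizer_le_normalizer_commutator (D : Subgroup G)
    (ht : t ∈ Subgroup.normalizer (D : Set G)) :
    t ∈ Subgroup.normalizer ((⁅D, D⁆ : Subgroup G) : Set G) := by
  have h : ∀ s ∈ Subgroup.normalizer (D : Set G), ∀ x ∈ ⁅D, D⁆, s * x * s⁻¹ ∈ ⁅D, D⁆ := by
    intro s hs x hx
    have h1 : (⁅D, D⁆ : Subgroup G).map (MulAut.conj s).toMonoidHom ≤ ⁅D, D⁆ := by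
      rw [Subgroup.map_commutator]
      have : D.map (MulAut.conj s).toMonoidHom ≤ D := by
        rintro _ ⟨y, hy, rfl⟩
        exact (Subgroup.mem_normalizer_iff.1 hs y).1 hy
      exact Subgroup.commutator_mono this this
    exact h1 ⟨x, hx, rfl⟩
  refine mem_normalizer_of_conj_mem (h t ht) fun x hx => ?_
  simpa using h t⁻¹ (inv_mem ht) x hx

end Tame

section Solvable

variable {G : Type*} [Group G] {t : G}

/-- The derived series of a subgroup, as a sequence of subgroups of the ambient group. -/
def commSeries (D : Subgroup G) : ℕ → Subgroup G
  | 0 => D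
  | n + 1 => commSeries ⁅D, D⁆ n

theorem commSeries_mono {D E : Subgroup G} (h : D ≤ E) (n : ℕ) :
    commSeries D n ≤ commSeries E n := by
  induction n generalizing D E with
  | zero => exact h
  | succ n ih => exact ih (Subgroup.commutator_mono h h)

theorem mem_normalizer_of_commutator_le {B D : Subgroup G} (h : ⁅D, D⁆ ≤ B) (hBD : B ≤ D) {a : G}
    (ha : a ∈ D) : a ∈ Subgroup.normalizer (B : Set G) := by
  have key : ∀ a ∈ D, ∀ x ∈ B, a * x * a⁻¹ ∈ B := by
    intro a ha x hx
    have := mul_mem (h (Subgroup.commutator_mem_commutator ha (hBD hx))) hx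
    rwa [commutatorElement_def, inv_mul_cancel_right] at this
  refine mem_normalizer_of_conj_mem (key a ha) fun x hx => ?_
  simpa using key a⁻¹ (inv_mem ha) x hx

theorem chain_commutator {D : Subgroup G} (hD : D.FG) :
    Relation.ReflTransGen SubgroupStep ⁅D, D⁆ D := by
  obtain ⟨S, hSD, hS⟩ := (Subgroup.fg_iff D).1 hD
  have hle : ⁅D, D⁆ ≤ D := Subgroup.commutator_le_self D
  have key : ∀ F : Set G, F.Finite → F ⊆ D →
      Relation.ReflTransGen SubgroupStep ⁅D, D⁆ (⁅D, D⁆ ⊔ Subgroup.closure F) := by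
    intro F hF
    induction F, hF using Set.Finite.induction_on with
    | empty =>
      intro _
      rw [Subgroup.closure_empty, sup_bot_eq]
    | @insert a F _ _ ih =>
      intro haF
      refine (ih ((Set.subset_insert a F).trans haF)).tail (Or.inr ⟨a, ?_, ?_⟩)
      · refine mem_normalizer_of_commutator_le le_sup_left (sup_le hle ?_)
          (haF (Set.mem_insert a F))
        exact (Subgroup.closure_le D).2 ((Set.subset_insert a F).trans haF)
      · rw [Set.insert_eq, Set.union_comm, Subgroup.closure_union, sup_assoc,
          Subgroup.zpowers_eq_closure]
  have := key S hS (hSD ▸ Subgroup.subset_closure)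
  rwa [hSD, sup_eq_right.2 hle] at this

/-- A finitely generated subgroup `D` normalized by `t` consists of tame elements if its commutator
subgroup does so for all powers of `t`: some power of `t` acts unipotently on `D ⧸ ⁅D, D⁆`. -/
theorem LocallySubexponential.le_tameSubgroup_of_commutator (hG : LocallySubexponential G)
    {A D : Subgroup G} (hA : t ∈ Subgroup.normalizer (A : Set G)) (hDA : D ≤ A) (hD : D.FG)
    (ht : t ∈ Subgroup.normalizer (D : Set G))
    (hcomm : ∀ k : ℕ, ⁅D, D⁆ ≤ tameSubgroup A (t ^ k)) : D ≤ tameSubgroup A t := by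
  have hDfg : Group.FG D := (Group.fg_iff_subgroup_fg D).2 hD
  let M := Additive (Abelianization D)
  have hMfg : Group.FG (Abelianization D) :=
    Group.fg_of_surjective (f := Abelianization.of) (QuotientGroup.mk'_surjective _)
  have : Module.Finite ℤ M := Module.Finite.iff_addGroup_fg.2 (GroupFG.iff_add_fg.1 hMfg)
  let σ : D ≃* D := normalizerConj ht
  let φ : M ≃ₗ[ℤ] M := σ.abelianizationCongr.toAdditive.toIntLinearEquiv
  let of : D → M := fun x => Additive.ofMul (Abelianization.of x)
  have hof : Function.Surjective of := fun m =>
    (QuotientGroup.mk'_surjective (commutator D) m.toMul)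
  have hofmul : ∀ x y, of (x * y) = of x + of y := fun x y => by simp [of]
  have hofinv : ∀ x, of x⁻¹ = -of x := fun x => by simp [of]
  have hφ : ∀ x, φ (of x) = of (σ x) := fun x => rfl
  obtain ⟨k, m, hk, hkm⟩ := φ.exists_pow_sub_one_pow_eq_zero fun l z hl hlz => by
    classical
    obtain ⟨y, hy⟩ : ∃ y, l y ≠ 0 := by
      by_contra! hcon
      exact hl (LinearMap.ext hcon)
    obtain ⟨h, rfl⟩ := hof y
    let l' : G → ℂ := fun x => if hx : x ∈ D then l (of ⟨x, hx⟩) else 0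
    have hl' : ∀ x (hx : x ∈ D), l' x = l (of ⟨x, hx⟩) := fun x hx => dif_pos hx
    refine hG.norm_eigenvalue_le_one (l := l') ht ?_ ?_ h.2 ?_
    · intro x hx y hy
      rw [hl' x hx, hl' y hy, hl' _ (mul_mem hx hy), ← map_add, ← hofmul]
      rfl
    · intro x hx
      rw [hl' x hx, hl' _ ((Subgroup.mem_normalizer_iff.1 ht x).1 hx), ← hlz, hφ]
      rfl
    · rwa [hl' h h.2]
  have hφk : ∀ (n : ℕ) (x : D), ((φ : Module.End ℤ M) ^ n) (of x) = of ((σ ^ n : MulAut D) x) := by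
    intro n
    induction n with
    | zero => intro x; rfl
    | succ n ih =>
      intro x
      rw [pow_succ, pow_succ, Module.End.mul_apply, MulAut.mul_apply, ← ih]
      rfl
  have hσk : ∀ (n : ℕ) (x : D), (((σ ^ n : MulAut D) x : D) : G) = t ^ n * x * (t ^ n)⁻¹ := by
    intro n
    induction n with
    | zero => intro x; simp
    | succ n ih =>
      intro x
      rw [pow_succ, MulAut.mul_apply, ih, pow_succ]
      change t ^ n * (t * x * t⁻¹) * _ = _
      group
  have key : ∀ (j : ℕ) (x : D), (((φ : Module.End ℤ M) ^ k - 1) ^ j) (of x) = 0 →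
      (x : G) ∈ tameSubgroup A (t ^ k) := by
    intro j
    induction j with
    | zero =>
      intro x hx
      have hx1 : Abelianization.of x = 1 := hx
      have hx2 : x ∈ commutator D := (QuotientGroup.eq_one_iff x).1 hx1
      have hx3 : (x : G) ∈ (commutator D).map D.subtype := ⟨x, hx2, rfl⟩
      rw [commutator_def, Subgroup.map_commutator, ← MonoidHom.range_eq_map,
        Subgroup.range_subtype] at hx3
      exact hcomm k hx3
    | succ j ih =>
      intro x hx
      refine mem_tameSubgroup_of_commutator (hDA x.2) ?_
      rw [← hσk, ← Subgroup.coe_inv, ← Subgroup.coe_mul]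
      refine ih _ ?_
      rw [pow_succ, Module.End.mul_apply, LinearMap.sub_apply, hφk, Module.End.one_apply] at hx
      rw [hofmul, hofinv, neg_add_eq_sub]
      exact hx
  intro x hx
  refine tameSubgroup_pow_le hA hk (key m ⟨x, hx⟩ ?_)
  rw [hkm]
  rfl

theorem LocallySubexponential.le_tameSubgroup_of_solvable (hG : LocallySubexponential G)
    {A D : Subgroup G} (hDA : D ≤ A) (hD : D.FG) {n : ℕ} (hn : commSeries D n = ⊥)
    (hA : t ∈ Subgroup.normalizer (A : Set G)) (ht : t ∈ Subgroup.normalizer (D : Set G)) :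
    D ≤ tameSubgroup A t := by
  induction n generalizing D t with
  | zero =>
    rw [show D = ⊥ from hn]
    exact bot_le
  | succ n ih =>
    refine hG.le_tameSubgroup_of_commutator hA hDA hD ht fun k => ?_
    refine ih ((Subgroup.commutator_le_self D).trans hDA)
      (hG.fg_of_chain (chain_commutator hD) hD) hn (pow_mem hA k) ?_
    exact pow_mem (normalizer_le_normalizer_commutator D ht) k

end Solvable

section PolynomialGrowth

open scoped commutatorElement

variable {G : Type*} [Group G] {t : G}

/-- `A` has a solvable subgroup of finite index. -/
def IsVirtuallySolvable (A : Subgroup G) : Prop :=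
  ∃ M ≤ A, M.relIndex A ≠ 0 ∧ ∃ n, commSeries M n = ⊥

theorem finite_monoidHom_of_fg {A P : Type*} [Group A] [Group P] [Group.FG A] [Finite P] :
    Finite (A →* P) := by
  obtain ⟨S, hS, hSfin⟩ := Group.fg_iff.1 (inferInstance : Group.FG A)
  have := hSfin.to_subtype
  refine Finite.of_injective (fun (f : A →* P) (s : S) => f s) fun f g hfg => ?_
  exact MonoidHom.eq_of_eqOn_dense hS fun s hs => congrFun hfg ⟨s, hs⟩

/-- A finite-index subgroup of a finitely generated group contains a finite-index subgroup that is
invariant under all automorphisms, here under conjugation by normalizing elements: the intersection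
of the kernels of all actions on the set of cosets. -/
theorem exists_finite_index_normalized {A M : Subgroup G} (hA : A.FG) (hM : M.relIndex A ≠ 0) :
    ∃ K ≤ M ⊓ A, K.relIndex A ≠ 0 ∧
      ∀ t ∈ Subgroup.normalizer (A : Set G), t ∈ Subgroup.normalizer (K : Set G) := by
  have hAfg : Group.FG A := (Group.fg_iff_subgroup_fg A).2 hA
  have hfin : (M.subgroupOf A).FiniteIndex := ⟨hM⟩
  let P := Equiv.Perm (A ⧸ M.subgroupOf A)
  have : Finite (A →* P) := finite_monoidHom_of_fg
  let K : Subgroup A := ⨅ f : A →* P, f.ker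
  have hK : K.FiniteIndex := Subgroup.finiteIndex_iInf fun f => Subgroup.finiteIndex_ker f
  have hmem : ∀ x : A, x ∈ K ↔ ∀ f : A →* P, f x = 1 := fun x => by
    simp [K, Subgroup.mem_iInf, MonoidHom.mem_ker]
  refine ⟨K.map A.subtype, le_inf ?_ (Subgroup.map_subtype_le K), ?_, fun t ht => ?_⟩
  · rintro _ ⟨x, hx, rfl⟩
    have h1 : x ∈ (MulAction.toPermHom A (A ⧸ M.subgroupOf A)).ker := (hmem x).1 hx _
    rw [← Subgroup.normalCore_eq_ker] at h1
    have h2 := Subgroup.normalCore_le _ h1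
    exact h2
  · rw [Subgroup.relIndex, Subgroup.subgroupOf, Subgroup.comap_map_eq_self_of_injective
      A.subtype_injective]
    exact hK.index_ne_zero
  · have key : ∀ σ : A ≃* A, ∀ x ∈ K, σ x ∈ K := fun σ x hx =>
      (hmem _).2 fun f => (hmem x).1 hx (f.comp σ.toMonoidHom)
    refine mem_normalizer_of_conj_mem ?_ ?_
    · rintro _ ⟨x, hx, rfl⟩
      exact ⟨_, key (normalizerConj ht) x hx, rfl⟩
    · rintro _ ⟨x, hx, rfl⟩
      exact ⟨_, key (normalizerConj ht).symm x hx, rfl⟩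

theorem LocallySubexponential.le_tameSubgroup (hG : LocallySubexponential G) {A : Subgroup G}
    (hA : A.FG) (hs : IsVirtuallySolvable A) (ht : t ∈ Subgroup.normalizer (A : Set G)) :
    A ≤ tameSubgroup A t := by
  obtain ⟨M, hMA, hMi, n, hn⟩ := hs
  obtain ⟨K, hKM, hKi, hKt⟩ := exists_finite_index_normalized hA hMi
  have hKA : K ≤ A := hKM.trans inf_le_right
  have hKn : commSeries K n = ⊥ := le_bot_iff.1 (hn ▸ commSeries_mono (hKM.trans inf_le_left) n)
  have hKfg : K.FG := fg_of_relIndex_ne_zero hKA hKi hA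
  intro x hx
  -- two of the conjugates of `x` by powers of `t` lie in the same coset of `K`
  obtain ⟨R, hR, hRA, hcov⟩ := relIndex_ne_zero_iff_exists_finite.1 hKi
  have hconj : ∀ i : ℕ, t ^ i * x * (t ^ i)⁻¹ ∈ A := fun i => by simpa using conj_zpow_mem ht hx i
  choose r hr hrK using fun i : ℕ => hcov _ (hconj i)
  obtain ⟨i, -, j, -, hij, he⟩ := Set.infinite_univ.exists_ne_map_eq_of_mapsTo
    (f := r) (fun i _ => hr i) hR
  wlog hlt : i < j generalizing i j
  · exact this j i hij.symm he.symm (by omega)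
  obtain ⟨k, rfl⟩ := Nat.exists_eq_add_of_lt hlt
  have h1 : (t ^ i * x * (t ^ i)⁻¹)⁻¹ *
      (t ^ (i + k + 1) * x * (t ^ (i + k + 1))⁻¹) ∈ K := by
    have := mul_mem (inv_mem (hrK i)) (hrK (i + k + 1))
    rw [he] at this
    rwa [show ((r (i + k + 1))⁻¹ * (t ^ i * x * (t ^ i)⁻¹))⁻¹ *
      ((r (i + k + 1))⁻¹ * (t ^ (i + k + 1) * x * (t ^ (i + k + 1))⁻¹)) =
      (t ^ i * x * (t ^ i)⁻¹)⁻¹ * (t ^ (i + k + 1) * x * (t ^ (i + k + 1))⁻¹) by group] at this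
  have h2 : x⁻¹ * (t ^ (k + 1) * x * (t ^ (k + 1))⁻¹) ∈ K := by
    have := conj_zpow_mem (hKt t ht) h1 (-(i : ℤ))
    rw [zpow_neg, zpow_natCast] at this
    rwa [show (t ^ i)⁻¹ * ((t ^ i * x * (t ^ i)⁻¹)⁻¹ *
      (t ^ (i + k + 1) * x * (t ^ (i + k + 1))⁻¹)) * ((t ^ i)⁻¹)⁻¹ =
      x⁻¹ * (t ^ (k + 1) * x * (t ^ (k + 1))⁻¹) by rw [add_assoc, pow_add]; group] at this
  refine tameSubgroup_pow_le ht (Nat.succ_pos k) (mem_tameSubgroup_of_commutator hx ?_)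
  exact hG.le_tameSubgroup_of_solvable hKA hKfg hKn (pow_mem ht _) (pow_mem (hKt t ht) _) h2

theorem IsVirtuallySolvable.of_relIndex_ne_zero {A B : Subgroup G} (hAB : A ≤ B)
    (hi : A.relIndex B ≠ 0) (hA : IsVirtuallySolvable A) : IsVirtuallySolvable B := by
  obtain ⟨M, hMA, hMi, hn⟩ := hA
  exact ⟨M, hMA.trans hAB, Subgroup.relIndex_ne_zero_trans hMi hi, hn⟩

theorem commutator_sup_zpowers_le {K : Subgroup G} (ht : t ∈ Subgroup.normalizer (K : Set G)) :
    ⁅K ⊔ Subgroup.zpowers t, K ⊔ Subgroup.zpowers t⁆ ≤ K := by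
  rw [Subgroup.commutator_le]
  intro x hx y hy
  obtain ⟨a, ha, i, rfl⟩ := exists_mul_zpow_of_mem_sup ht hx
  obtain ⟨b, hb, j, rfl⟩ := exists_mul_zpow_of_mem_sup ht hy
  have e : ⁅a * t ^ i, b * t ^ j⁆ = a * (t ^ i * b * (t ^ i)⁻¹) *
      (t ^ j * a⁻¹ * (t ^ j)⁻¹) * b⁻¹ := by
    rw [commutatorElement_def]
    have : Commute (t ^ i) (t ^ j) := Commute.zpow_zpow_self t i j
    have h1 : t ^ i * b * t ^ j * (t ^ i)⁻¹ = t ^ i * b * (t ^ i)⁻¹ * t ^ j := by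
      rw [mul_assoc _ (t ^ j), this.symm.inv_right.eq]
      group
    calc a * t ^ i * (b * t ^ j) * (a * t ^ i)⁻¹ * (b * t ^ j)⁻¹
        = a * (t ^ i * b * t ^ j * (t ^ i)⁻¹) * a⁻¹ * (t ^ j)⁻¹ * b⁻¹ := by group
      _ = _ := by rw [h1]; group
  rw [e]
  exact mul_mem (mul_mem (mul_mem ha (conj_zpow_mem ht hb i)) (conj_zpow_mem ht (inv_mem ha) j))
    (inv_mem hb)

theorem IsVirtuallySolvable.cyclic_step {A : Subgroup G} (hA : A.FG) (hs : IsVirtuallySolvable A)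
    (ht : t ∈ Subgroup.normalizer (A : Set G)) : IsVirtuallySolvable (A ⊔ Subgroup.zpowers t) := by
  obtain ⟨M, hMA, hMi, n, hn⟩ := hs
  obtain ⟨K, hKM, hKi, hKt⟩ := exists_finite_index_normalized hA hMi
  have hKA : K ≤ A := hKM.trans inf_le_right
  refine ⟨K ⊔ Subgroup.zpowers t, sup_le_sup_right hKA _, ?_, n + 1, ?_⟩
  · obtain ⟨R, hR, hRA, hcov⟩ := relIndex_ne_zero_iff_exists_finite.1 hKi
    refine relIndex_ne_zero_iff_exists_finite.2
      ⟨R, hR, fun x hx => Subgroup.mem_sup_left (hRA hx), fun b hb => ?_⟩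
    obtain ⟨a, ha, i, rfl⟩ := exists_mul_zpow_of_mem_sup ht hb
    obtain ⟨r, hr, h⟩ := hcov a ha
    refine ⟨r, hr, ?_⟩
    rw [← mul_assoc]
    exact Subgroup.mul_mem_sup h (Subgroup.zpow_mem_zpowers t i)
  · refine le_bot_iff.1 (le_trans ?_ hn.le)
    exact commSeries_mono ((commutator_sup_zpowers_le (hKt t ht)).trans (hKM.trans inf_le_left)) n

/-- Extension of the polynomial bound by a cyclic group that acts with polynomial distortion. -/
theorem LocallyPolynomial.cyclic_step {A : Subgroup G} (hA : LocallyPolynomial A)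
    (ht : t ∈ Subgroup.normalizer (A : Set G)) (h₁ : A ≤ tameSubgroup A t)
    (h₂ : A ≤ tameSubgroup A t⁻¹) : LocallyPolynomial (A ⊔ Subgroup.zpowers t) := by
  intro S hS hSB
  choose! a ha e he using fun s (hs : s ∈ S) => exists_mul_zpow_of_mem_sup ht (hSB hs)
  let F := a '' S
  have hF : F.Finite := hS.image a
  have hFA : F ⊆ A := by
    rintro _ ⟨s, hs, rfl⟩
    exact ha s hs
  -- a common polynomial bound for the conjugates of the elements of `F`
  obtain ⟨U, hU, hUA, C, d, hconj⟩ : ∃ U : Set G, U.Finite ∧ U ⊆ A ∧ ∃ C d : ℕ,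
      ∀ x ∈ F, ∀ j : ℤ, t ^ j * x * (t ^ j)⁻¹ ∈ wordBall U (C * (j.natAbs + 1) ^ d) := by
    clear_value F
    induction F, hF using Set.Finite.induction_on with
    | empty => exact ⟨∅, Set.finite_empty, Set.empty_subset _, 0, 0, by simp⟩
    | @insert x F _ _ ih =>
      obtain ⟨U, hU, hUA, C, d, h⟩ := ih ((Set.subset_insert x F).trans hFA)
      obtain ⟨U₁, hU₁, hUA₁, C₁, d₁, hh₁⟩ := h₁ (hFA (Set.mem_insert x F))
      obtain ⟨U₂, hU₂, hUA₂, C₂, d₂, hh₂⟩ := h₂ (hFA (Set.mem_insert x F))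
      refine ⟨U ∪ (U₁ ∪ U₂), hU.union (hU₁.union hU₂),
        Set.union_subset hUA (Set.union_subset hUA₁ hUA₂), C + (C₁ + C₂), d + (d₁ + d₂), ?_⟩
      rintro y (rfl | hy) j
      · obtain ⟨n, rfl | rfl⟩ := j.eq_nat_or_neg
        · have := wordBall_mono_left (T := U ∪ (U₁ ∪ U₂))
            (Set.subset_union_left.trans Set.subset_union_right) _ (hh₁ n)
          rw [zpow_natCast]
          refine wordBall_mono_right _ ?_ this
          simp only [Int.natAbs_natCast]
          gcongr <;> omega
        · have := wordBall_mono_left (T := U ∪ (U₁ ∪ U₂))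
            (Set.subset_union_right.trans Set.subset_union_right) _ (hh₂ n)
          rw [zpow_neg, zpow_natCast, ← inv_pow]
          refine wordBall_mono_right _ ?_ this
          simp only [Int.natAbs_neg, Int.natAbs_natCast]
          gcongr <;> omega
      · refine wordBall_mono_right _ ?_ (wordBall_mono_left Set.subset_union_left _ (h y hy j))
        gcongr <;> omega
  have hT : (insert t F).Finite := hF.insert t
  have hball : ∀ n : ℕ, ∀ x ∈ wordBall (insert t F) n, ∃ y ∈ wordBall U (n * (C * (n + 1) ^ d)),
      ∃ i : ℤ, i.natAbs ≤ n ∧ x = y * t ^ i := by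
    intro n
    induction n with
    | zero =>
      intro x hx
      rw [wordBall_zero] at hx
      exact ⟨1, one_mem_wordBall _ _, 0, by simp, by simpa using hx⟩
    | succ n ih =>
      intro x hx
      rw [wordBall_add] at hx
      obtain ⟨w, hw, z, hz, rfl⟩ := hx
      obtain ⟨y, hy, i, hi, rfl⟩ := ih w hw
      have hmono : n * (C * (n + 1) ^ d) + C * (i.natAbs + 1) ^ d ≤
          (n + 1) * (C * (n + 1 + 1) ^ d) := by
        rw [add_mul, one_mul]
        gcongr <;> omega
      have hmul : ∀ v ∈ wordBall U (C * (i.natAbs + 1) ^ d),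
          y * v ∈ wordBall U ((n + 1) * (C * (n + 1 + 1) ^ d)) := fun v hv =>
        wordBall_mono_right _ hmono (mul_mem_wordBall hy hv)
      have hy' := hmul 1 (one_mem_wordBall _ _)
      rw [mul_one] at hy'
      rw [wordBall_one] at hz
      rcases hz with (hz | hz | hz) | hz | hz
      · rw [Set.mem_singleton_iff] at hz
        subst hz
        exact ⟨y, hy', i, by omega, by simp⟩
      · subst hz
        refine ⟨y, hy', i + 1, by omega, ?_⟩
        simp [zpow_add, mul_assoc]
      · refine ⟨_, hmul _ (hconj z hz i), i, by omega, ?_⟩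
        simp [mul_assoc]
      · rw [inv_eq_iff_eq_inv] at hz
        subst hz
        refine ⟨y, hy', i - 1, by omega, ?_⟩
        simp [zpow_sub, mul_assoc]
      · refine ⟨_, hmul _ (inv_mem_wordBall (hconj z⁻¹ hz i)), i, by omega, ?_⟩
        simp [mul_assoc]
  have hpoly : PolynomiallyBounded (groupGrowth (insert t F)) := by
    have hp₁ : PolynomiallyBounded fun n => groupGrowth U (n * (C * (n + 1) ^ d)) :=
      (hA U hU hUA).of_le_comp C (d + 1) fun n => groupGrowth_mono hU (by
        rw [pow_succ]
        nlinarith [Nat.zero_le (C * (n + 1) ^ d)])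
    have hp₂ : PolynomiallyBounded fun n => 2 * n + 1 := ⟨2, 1, fun n => by simp only [pow_one]; omega⟩
    refine (hp₁.mul hp₂).mono fun n => ?_
    have hsub : wordBall (insert t F) n ⊆ Set.image2 (fun y (i : ℤ) => y * t ^ i)
        (wordBall U (n * (C * (n + 1) ^ d))) (Finset.Icc (-n : ℤ) n) := by
      intro x hx
      obtain ⟨y, hy, i, hi, rfl⟩ := hball n x hx
      exact ⟨y, hy, i, by simp only [Finset.coe_Icc, Set.mem_Icc]; omega, rfl⟩
    have hfin := wordBall_finite hU (n * (C * (n + 1) ^ d))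
    refine (Set.ncard_le_ncard hsub (hfin.image2 _ (Finset.finite_toSet _))).trans ?_
    rw [← Set.image_prod]
    refine (Set.ncard_image_le (hfin.prod (Finset.finite_toSet _))).trans ?_
    rw [Set.ncard_prod, Set.ncard_coe_finset, Int.card_Icc, groupGrowth_eq]
    gcongr
    omega
  obtain ⟨k, hk⟩ := exists_subset_wordBall (S := insert t F) hS (by
    intro s hs
    rw [he s hs]
    refine mul_mem (Subgroup.subset_closure (Or.inr ⟨s, hs, rfl⟩)) (zpow_mem ?_ _)
    exact Subgroup.subset_closure (Or.inl rfl))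
  exact hpoly.of_subset hT hk

/-- The Milnor–Wolf theorem: a finitely generated group of subexponential growth that is built from
finite-index and cyclic steps has polynomial growth. -/
theorem IsPolycyclicOrFinite.polynomiallyBounded (h : IsPolycyclicOrFinite G)
    (hfg : Group.FG G) (hG : LocallySubexponential G) {S : Set G} (hS : S.Finite) :
    PolynomiallyBounded (groupGrowth S) := by
  have key : ∀ A : Subgroup G, Relation.ReflTransGen SubgroupStep A ⊤ →
      IsVirtuallySolvable A → LocallyPolynomial A → LocallyPolynomial (⊤ : Subgroup G) := by
    intro A hA
    induction hA using Relation.ReflTransGen.head_induction_on with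
    | refl => exact fun _ h => h
    | @head A B hAB hB ih =>
      intro hs hp
      have hBfg := hG.fg_of_chain hB (Group.fg_def.1 hfg)
      have hAfg := hG.fg_of_step hAB hBfg
      rcases hAB with ⟨hle, hi⟩ | ⟨t, ht, rfl⟩
      · exact ih (hs.of_relIndex_ne_zero hle hi) (hp.of_relIndex_ne_zero hi)
      · exact ih (hs.cyclic_step hAfg ht) (hp.cyclic_step ht (hG.le_tameSubgroup hAfg hs ht)
          (hG.le_tameSubgroup hAfg hs (inv_mem ht)))
  refine key ⊥ h ⟨⊥, le_rfl, by simp, 0, rfl⟩ ?_ S hS (Set.subset_univ S)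
  intro T hT hT1
  refine ⟨1, 0, fun n => ?_⟩
  have : wordBall T n ⊆ {1} := by
    refine (wordBall_subset_closure T n).trans ?_
    rw [← Subgroup.coe_bot]
    exact (Subgroup.closure_le ⊥).2 hT1
  simpa [groupGrowth_eq] using Set.ncard_le_ncard this (Set.finite_singleton 1)

/-- Elementary amenable groups do not have intermediate growth. -/
theorem HasIntermediateGrowth.not_isElementaryAmenable {G : Type u} [Group G]
    (h : HasIntermediateGrowth G) : ¬ IsElementaryAmenable G := by
  intro hea
  have hsub := h.locallySubexponential
  obtain ⟨S, hS, htop, hpol, -⟩ := h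
  have hfg : Group.FG G := Group.fg_iff.2 ⟨S, htop, hS⟩
  exact hpol ((hea.isPolycyclicOrFinite hfg hsub).polynomiallyBounded hfg hsub hS)

end PolynomialGrowth

/-! ### Amenability of groups of subexponential growth -/

section Amenable

open Filter Topology

variable {G : Type*} [Group G]

theorem exists_growth_ratio_le {S : Set G} (hS : S.Finite)
    (h : ¬ ExponentiallyGrowing (groupGrowth S)) {ε : ℝ} (hε : 0 < ε) :
    ∃ n, (groupGrowth S (n + 1) : ℝ) ≤ (1 + ε) * groupGrowth S n := by
  by_contra! hcon
  refine h ⟨1 + ε, by linarith, fun n => ?_⟩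
  induction n with
  | zero =>
    rw [pow_zero]
    exact_mod_cast groupGrowth_pos hS 0
  | succ n ih =>
    rw [pow_succ']
    exact (mul_le_mul_of_nonneg_left ih (by linarith)).trans (hcon n).le

/-- If `φ⁻¹` maps each ball into the next larger one, then `φ` increases the density of a set in a
ball by at most the relative size of the sphere around that ball. -/
theorem density_image_le {S : Set G} (hS : S.Finite) (φ : Equiv.Perm G) {n : ℕ}
    (hφ : ∀ x ∈ wordBall S n, φ.symm x ∈ wordBall S (n + 1)) {ε : ℝ}
    (hn : (groupGrowth S (n + 1) : ℝ) ≤ (1 + ε) * groupGrowth S n) (A : Set G) :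
    ((φ '' A ∩ wordBall S n).ncard : ℝ) / groupGrowth S n ≤
      ((A ∩ wordBall S n).ncard : ℝ) / groupGrowth S n + ε := by
  have hpos : (0 : ℝ) < groupGrowth S n := by exact_mod_cast groupGrowth_pos hS n
  have hB := wordBall_finite hS n
  have hB' := wordBall_finite hS (n + 1)
  have h1 : (φ '' A ∩ wordBall S n).ncard ≤
      (A ∩ wordBall S n).ncard + (wordBall S (n + 1) \ wordBall S n).ncard := by
    have hsub : φ '' A ∩ wordBall S n ⊆
        φ '' ((A ∩ wordBall S n) ∪ (wordBall S (n + 1) \ wordBall S n)) := by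
      rintro _ ⟨⟨x, hx, rfl⟩, hxn⟩
      have := hφ _ hxn
      rw [φ.symm_apply_apply] at this
      refine ⟨x, ?_, rfl⟩
      by_cases hxB : x ∈ wordBall S n
      · exact Or.inl ⟨hx, hxB⟩
      · exact Or.inr ⟨this, hxB⟩
    have hfin : ((A ∩ wordBall S n) ∪ (wordBall S (n + 1) \ wordBall S n)).Finite :=
      (hB.inter_of_right _).union hB'.sdiff
    exact (Set.ncard_le_ncard hsub (hfin.image _)).trans
      ((Set.ncard_image_le hfin).trans (Set.ncard_union_le _ _))
  have h2 := Set.ncard_sdiff_add_ncard_of_subset (wordBall_mono_right S n.le_succ) hB'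
  rw [← groupGrowth_eq, ← groupGrowth_eq] at h2
  have h1' : ((φ '' A ∩ wordBall S n).ncard : ℝ) ≤
      (A ∩ wordBall S n).ncard + (wordBall S (n + 1) \ wordBall S n).ncard := by exact_mod_cast h1
  have h2' : ((wordBall S (n + 1) \ wordBall S n).ncard : ℝ) + groupGrowth S n =
      groupGrowth S (n + 1) := by exact_mod_cast h2
  rw [div_add' _ _ _ hpos.ne']
  refine div_le_div_of_nonneg_right ?_ hpos.le
  linarith

/-- The balls along a sequence of radii with small relative spheres form a two-sided Følner
sequence; the limit of the densities along an ultrafilter is an invariant mean. -/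
theorem HasIntermediateGrowth.isAmenableGroup {G : Type u} [Group G]
    (h : HasIntermediateGrowth G) : IsAmenableGroup G := by
  obtain ⟨S, hS, htop, -, hexp⟩ := h
  choose r hr using fun k : ℕ =>
    exists_growth_ratio_le hS hexp (Nat.one_div_pos_of_nat (α := ℝ) (n := k))
  have hpos : ∀ k, (0 : ℝ) < groupGrowth S (r k) := fun k => by
    exact_mod_cast groupGrowth_pos hS (r k)
  let m : ℕ → Set G → ℝ := fun k A => ((A ∩ wordBall S (r k)).ncard : ℝ) / groupGrowth S (r k)
  let F : Ultrafilter ℕ := hyperfilter ℕ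
  have hF : (F : Filter ℕ) ≤ atTop := Nat.hyperfilter_le_atTop
  have hm01 : ∀ k A, m k A ∈ Set.Icc (0 : ℝ) 1 := by
    intro k A
    refine ⟨by positivity, ?_⟩
    rw [div_le_one (hpos k)]
    exact_mod_cast Set.ncard_le_ncard Set.inter_subset_right (wordBall_finite hS _)
  have hlim : ∀ A, ∃ x ∈ Set.Icc (0 : ℝ) 1, Tendsto (fun k => m k A) F (𝓝 x) := by
    intro A
    exact isCompact_Icc.ultrafilter_le_nhds (F.map fun k => m k A)
      (le_principal_iff.2 (Filter.mem_map.2 (Filter.univ_mem' fun k => hm01 k A)))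
  choose μ hμ01 hμ using hlim
  have hle : ∀ φ : Equiv.Perm G,
      (∀ n, ∀ x ∈ wordBall S n, φ.symm x ∈ wordBall S (n + 1)) → ∀ A, μ (φ '' A) ≤ μ A := by
    intro φ hφ A
    have ht : Tendsto (fun k : ℕ => m k A + 1 / ((k : ℝ) + 1)) F (𝓝 (μ A + 0)) :=
      (hμ A).add (tendsto_one_div_add_atTop_nhds_zero_nat.mono_left hF)
    rw [add_zero] at ht
    exact le_of_tendsto_of_tendsto' (hμ _) ht fun k => density_image_le hS φ (hφ _) (hr k) A
  have hinv : ∀ φ : Equiv.Perm G, (∀ n, ∀ x ∈ wordBall S n, φ x ∈ wordBall S (n + 1)) →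
      (∀ n, ∀ x ∈ wordBall S n, φ.symm x ∈ wordBall S (n + 1)) → ∀ A, μ (φ '' A) = μ A := by
    intro φ h₁ h₂ A
    refine le_antisymm (hle φ h₂ A) ?_
    have := hle φ.symm h₁ (φ '' A)
    rwa [Set.image_image, funext φ.symm_apply_apply, Set.image_id'] at this
  have hgen : ∀ P : G → Prop, P 1 → (∀ x y, P x → P y → P (x * y)) → (∀ x ∈ wordBall S 1, P x) →
      ∀ g, P g := by
    intro P h1 hmul hP g
    have hg : g ∈ Subgroup.closure S := htop ▸ Subgroup.mem_top g
    obtain ⟨n, hn⟩ := exists_mem_wordBall hg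
    induction n generalizing g with
    | zero =>
      rw [wordBall_zero] at hn
      rwa [Set.mem_singleton_iff.1 hn]
    | succ n ih =>
      rw [wordBall_add] at hn
      obtain ⟨x, hx, y, hy, rfl⟩ := hn
      exact hmul x y (ih x (htop ▸ Subgroup.mem_top x) hx) (hP y hy)
  have hleft : ∀ (g : G) (A : Set G), μ A = μ ((fun x => g * x) '' A) := by
    refine hgen _ (fun A => by simp) (fun x y hx hy A => ?_) fun g hg A => ?_
    · rw [hy A, hx, Set.image_image]
      simp only [mul_assoc]
    · refine (hinv (Equiv.mulLeft g) (fun n x hx => ?_) (fun n x hx => ?_) A).symm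
      · rw [add_comm]
        exact mul_mem_wordBall hg hx
      · rw [add_comm]
        exact mul_mem_wordBall (inv_mem_wordBall hg) hx
  have hright : ∀ (g : G) (A : Set G), μ A = μ ((fun x => x * g) '' A) := by
    refine hgen _ (fun A => by simp) (fun x y hx hy A => ?_) fun g hg A => ?_
    · rw [hx A, hy, Set.image_image]
      simp only [mul_assoc]
    · exact (hinv (Equiv.mulRight g) (fun n x hx => mul_mem_wordBall hx hg)
        (fun n x hx => mul_mem_wordBall hx (inv_mem_wordBall hg)) A).symm
  refine ⟨μ, hμ01, ?_, ?_, fun A g => ⟨hleft g A, hright g A⟩⟩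
  · refine tendsto_nhds_unique (hμ Set.univ) (tendsto_const_nhds.congr fun k => ?_)
    change (1 : ℝ) = _ / _
    rw [Set.univ_inter, ← groupGrowth_eq, div_self (hpos k).ne']
  · intro A B hAB
    refine tendsto_nhds_unique (hμ _) (((hμ A).add (hμ B)).congr fun k => ?_)
    change _ / _ + _ / _ = _ / _
    rw [← add_div, Set.union_inter_distrib_right, Set.ncard_union_eq _
      ((wordBall_finite hS _).inter_of_right _) ((wordBall_finite hS _).inter_of_right _)]
    · push_cast
      rfl
    · exact (Set.disjoint_iff_inter_eq_empty.2 hAB).mono Set.inter_subset_left Set.inter_subset_left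

end Amenable

/-! ### Grigorchuk's group acts by order automorphisms -/

namespace Grigorchuk

/-- The sequences `l` and `l'` differ first at the place `n`, where `l` is smaller. -/
def LexLtAt (n : ℕ) (l l' : ℕ → ℤ) : Prop :=
  (∀ i < n, l i = l' i) ∧ l n < l' n

theorem lexLtAt_zero {l l' : ℕ → ℤ} : LexLtAt 0 l l' ↔ l 0 < l' 0 := by
  simp [LexLtAt]

theorem lexLtAt_succ {n : ℕ} {l l' : ℕ → ℤ} : LexLtAt (n + 1) l l' ↔
    l 0 = l' 0 ∧ LexLtAt n (fun i => l (i + 1)) (fun i => l' (i + 1)) := by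
  refine ⟨fun h => ⟨h.1 0 n.succ_pos, fun i hi => h.1 (i + 1) (by omega), h.2⟩, fun h => ⟨?_, h.2.2⟩⟩
  rintro (_ | i) hi
  · exact h.1
  · exact h.2.1 i (by omega)

theorem LexLtAt.shiftHead {n : ℕ} {l l' : ℕ → ℤ} (h : LexLtAt n l l') (m : ℤ) :
    LexLtAt n (shiftHead m l) (shiftHead m l') := by
  cases n with
  | zero =>
    rw [lexLtAt_zero] at h ⊢
    exact Int.add_lt_add_right h m
  | succ n =>
    rw [lexLtAt_succ] at h ⊢
    exact ⟨congrArg (· + m) h.1, h.2⟩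

theorem LexLtAt.act {n : ℕ} {l l' : ℕ → ℤ} (h : LexLtAt n l l') (e : ℤ) (s : Letter) :
    LexLtAt n (act e s l) (act e s l') := by
  induction n generalizing l l' s with
  | zero =>
    have h0 : l 0 < l' 0 := lexLtAt_zero.1 h
    exact lexLtAt_zero.2 h0
  | succ n ih =>
    rw [lexLtAt_succ] at h ⊢
    refine ⟨h.1, ?_⟩
    by_cases h0 : Even (l 0)
    · have h0' : Even (l' 0) := h.1 ▸ h0
      simp only [Grigorchuk.act, if_pos h0, if_pos h0']
      exact h.2.shiftHead _
    · have h0' : ¬ Even (l' 0) := h.1 ▸ h0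
      simp only [Grigorchuk.act, if_neg h0, if_neg h0']
      exact ih h.2 s.next

/-- The permutations of the integer sequences that preserve the lexicographic order together with
the place of the first difference. -/
def lexSubgroup : Subgroup (Equiv.Perm (ℕ → ℤ)) where
  carrier := {g | ∀ n l l', LexLtAt n (g l) (g l') ↔ LexLtAt n l l'}
  one_mem' := fun _ _ _ => Iff.rfl
  mul_mem' := fun {g h} hg hh n l l' => (hg n (h l) (h l')).trans (hh n l l')
  inv_mem' := fun {g} hg n l l' => by
    have := hg n (g⁻¹ l) (g⁻¹ l')
    have e : ∀ l, g (g⁻¹ l) = l := g.apply_symm_apply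
    rw [e, e] at this
    exact this.symm

theorem torsionFreeGroup_le_lexSubgroup : torsionFreeGroup ≤ lexSubgroup := by
  have hgen : ∀ s, gen s ∈ lexSubgroup := fun s n l l' => by
    refine ⟨fun h => ?_, fun h => h.act 1 s⟩
    have := h.act (-1) s
    change LexLtAt n ((gen s).symm (gen s l)) ((gen s).symm (gen s l')) at this
    rwa [Equiv.symm_apply_apply, Equiv.symm_apply_apply] at this
  refine (Subgroup.closure_le _).2 ?_
  rintro g (rfl | rfl | rfl | rfl)
  · intro n l l'
    refine ⟨fun h => ?_, fun h => h.shiftHead 1⟩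
    have := h.shiftHead (-1)
    change LexLtAt n (genA.symm (genA l)) (genA.symm (genA l')) at this
    rwa [Equiv.symm_apply_apply, Equiv.symm_apply_apply] at this
  all_goals exact hgen _

theorem toLex_lt_iff {l l' : ℕ → ℤ} : toLex l < toLex l' ↔ ∃ n, LexLtAt n l l' := Iff.rfl

/-- Comparing two order automorphisms at the first point, in some well-ordering of the space, where
they differ gives a total order that is invariant under left multiplication. -/
theorem exists_leftOrder : ∃ _ : LinearOrder torsionFreeGroup, MulLeftStrictMono torsionFreeGroup := by
  let ι := (Cardinal.mk (ℕ → ℤ)).ord.ToType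
  obtain ⟨e⟩ : Nonempty (ι ≃ (ℕ → ℤ)) := Cardinal.eq.1 (Cardinal.mk_ord_toType _)
  let f : torsionFreeGroup → Lex (ι → Lex (ℕ → ℤ)) := fun g => toLex fun i => toLex (g.1 (e i))
  have hf : Function.Injective f := by
    intro g h hgh
    refine Subtype.ext (Equiv.ext fun l => ?_)
    have := congrFun (congrArg ofLex hgh) (e.symm l)
    simpa [f] using this
  let _ : LinearOrder torsionFreeGroup := LinearOrder.lift' f hf
  refine ⟨inferInstance, ⟨fun k g h hgh => ?_⟩⟩
  obtain ⟨i, hi, hlt⟩ := (show f g < f h from hgh)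
  refine (show f (k * g) < f (k * h) from ⟨i, fun j hj => ?_, ?_⟩)
  · exact congrArg (fun l => toLex (k.1 (ofLex l))) (hi j hj)
  · obtain ⟨n, hn⟩ := toLex_lt_iff.1 hlt
    exact toLex_lt_iff.2 ⟨n, (torsionFreeGroup_le_lexSubgroup k.2 n _ _).2 hn⟩

theorem not_isOfFinOrder (g : torsionFreeGroup) (hg : g ≠ 1) : ¬ IsOfFinOrder g := by
  obtain ⟨_, _⟩ := exists_leftOrder
  have : MulLeftMono torsionFreeGroup := mulLeftMono_of_mulLeftStrictMono _
  intro h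
  obtain ⟨n, hn, hgn⟩ := isOfFinOrder_iff_pow_eq_one.1 h
  rcases lt_or_gt_of_ne hg with h1 | h1
  · exact (pow_lt_one' h1 hn.ne').ne hgn
  · exact (one_lt_pow' h1 hn.ne').ne' hgn

theorem isDomain_monoidAlgebra (k : Type*) [Field k] :
    IsDomain (MonoidAlgebra k torsionFreeGroup) := by
  obtain ⟨_, _⟩ := exists_leftOrder
  exact NoZeroDivisors.to_isDomain _

end Grigorchuk

/-! ### Sections of elements of Grigorchuk's group -/

namespace Grigorchuk

/-- The sequence with first entry `m` and then the entries of `l`. -/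
def consSeq (m : ℤ) (l : ℕ → ℤ) : ℕ → ℤ
  | 0 => m
  | n + 1 => l n

/-- The permutation that adds `m` to the first entry of a sequence and applies `u` or `v` to the
remaining sequence if the first entry is even or odd. -/
def wr (m : ℤ) (u v : Equiv.Perm (ℕ → ℤ)) : Equiv.Perm (ℕ → ℤ) where
  toFun l := consSeq (l 0 + m) ((if Even (l 0) then u else v) fun i => l (i + 1))
  invFun l := consSeq (l 0 - m) ((if Even (l 0 - m) then u else v).symm fun i => l (i + 1))
  left_inv l := by
    funext n
    cases n <;> simp [consSeq]
  right_inv l := by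
    funext n
    cases n with
    | zero => simp [consSeq]
    | succ n =>
      simp only [consSeq]
      exact congrFun (Equiv.apply_symm_apply _ _) n

theorem wr_apply_zero (m : ℤ) (u v : Equiv.Perm (ℕ → ℤ)) (l : ℕ → ℤ) : wr m u v l 0 = l 0 + m :=
  rfl

theorem wr_apply_succ (m : ℤ) (u v : Equiv.Perm (ℕ → ℤ)) (l : ℕ → ℤ) (n : ℕ) :
    wr m u v l (n + 1) = (if Even (l 0) then u else v) (fun i => l (i + 1)) n :=
  rfl

theorem wr_mul_of_even (m : ℤ) {m' : ℤ} (h : Even m') (u v u' v' : Equiv.Perm (ℕ → ℤ)) :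
    wr m u v * wr m' u' v' = wr (m + m') (u * u') (v * v') := by
  ext l n
  rw [Equiv.Perm.mul_apply]
  cases n with
  | zero =>
    simp only [wr_apply_zero]
    ring
  | succ n =>
    simp only [wr_apply_succ, wr_apply_zero, Int.even_add, h, iff_true]
    split_ifs <;> rfl

theorem wr_mul_of_odd (m : ℤ) {m' : ℤ} (h : ¬ Even m') (u v u' v' : Equiv.Perm (ℕ → ℤ)) :
    wr m u v * wr m' u' v' = wr (m + m') (v * u') (u * v') := by
  ext l n
  rw [Equiv.Perm.mul_apply]
  cases n with
  | zero =>
    simp only [wr_apply_zero]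
    ring
  | succ n =>
    simp only [wr_apply_succ, wr_apply_zero, Int.even_add, h, iff_false]
    split_ifs <;> rfl

theorem wr_zero_mul (u v u' v' : Equiv.Perm (ℕ → ℤ)) :
    wr 0 u v * wr 0 u' v' = wr 0 (u * u') (v * v') := by
  rw [wr_mul_of_even _ (by simp), add_zero]

theorem wr_one : wr 0 1 1 = 1 := by
  ext l n
  cases n <;> simp [wr_apply_zero, wr_apply_succ]

theorem wr_zero_inv (u v : Equiv.Perm (ℕ → ℤ)) : (wr 0 u v)⁻¹ = wr 0 u⁻¹ v⁻¹ := by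
  rw [inv_eq_iff_mul_eq_one, wr_zero_mul, mul_inv_cancel, mul_inv_cancel, wr_one]

theorem wr_zero_pow (u v : Equiv.Perm (ℕ → ℤ)) (n : ℕ) : wr 0 u v ^ n = wr 0 (u ^ n) (v ^ n) := by
  induction n with
  | zero => simp [wr_one]
  | succ n ih => rw [pow_succ, ih, wr_zero_mul, pow_succ, pow_succ]

theorem wr_zero_zpow (u v : Equiv.Perm (ℕ → ℤ)) (n : ℤ) : wr 0 u v ^ n = wr 0 (u ^ n) (v ^ n) := by
  cases n with
  | ofNat n => simpa using wr_zero_pow u v n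
  | negSucc n => rw [zpow_negSucc, wr_zero_pow, wr_zero_inv, zpow_negSucc, zpow_negSucc]

theorem wr_injective {m : ℤ} {u v u' v' : Equiv.Perm (ℕ → ℤ)} (h : wr m u v = wr m u' v') :
    u = u' ∧ v = v' := by
  constructor
  · ext l n
    simpa [wr_apply_succ, consSeq] using congrFun (Equiv.congr_fun h (consSeq 0 l)) (n + 1)
  · ext l n
    simpa [wr_apply_succ, consSeq] using congrFun (Equiv.congr_fun h (consSeq 1 l)) (n + 1)

theorem genA_eq_wr : genA = wr 1 1 1 := by
  ext l n
  cases n with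
  | zero => rfl
  | succ n =>
    rw [wr_apply_succ, ite_self]
    rfl

theorem genA_zpow (m : ℤ) : genA ^ m = wr m 1 1 := by
  have hmul : ∀ i j : ℤ, wr i 1 1 * wr j 1 1 = wr (i + j) 1 1 := fun i j => by
    by_cases h : Even j
    · rw [wr_mul_of_even _ h, one_mul]
    · rw [wr_mul_of_odd _ h, one_mul]
  induction m using Int.induction_on with
  | zero => rw [zpow_zero, wr_one]
  | succ i ih => rw [zpow_add_one, ih, genA_eq_wr, hmul]
  | pred i ih =>
    rw [zpow_sub_one, ih, genA_eq_wr, mul_inv_eq_iff_eq_mul, hmul, sub_add_cancel]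

theorem gen_eq_wr (s : Letter) : gen s = wr 0 (genA ^ s.shift) (gen s.next) := by
  ext l n
  cases n with
  | zero => exact (add_zero _).symm
  | succ n =>
    rw [wr_apply_succ, genA_zpow]
    change act 1 s l (n + 1) = _
    rw [act]
    split_ifs
    · cases n with
      | zero => simp [shiftHead, wr_apply_zero]
      | succ n => simp [shiftHead, wr_apply_succ]
    · rfl

theorem genA_zpow_mul_wr (m : ℤ) (u v : Equiv.Perm (ℕ → ℤ)) :
    genA ^ m * wr 0 u v = wr m u v := by
  rw [genA_zpow, wr_mul_of_even _ (by simp), add_zero, one_mul, one_mul]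

theorem conj_genA_zpow_of_even {e : ℤ} (he : Even e) (u v : Equiv.Perm (ℕ → ℤ)) :
    genA ^ e * wr 0 u v * (genA ^ e)⁻¹ = wr 0 u v := by
  rw [mul_inv_eq_iff_eq_mul, genA_zpow_mul_wr, genA_zpow, wr_mul_of_even _ he, mul_one, mul_one,
    zero_add]

theorem conj_genA_zpow_of_odd {e : ℤ} (he : ¬ Even e) (u v : Equiv.Perm (ℕ → ℤ)) :
    genA ^ e * wr 0 u v * (genA ^ e)⁻¹ = wr 0 v u := by
  rw [mul_inv_eq_iff_eq_mul, genA_zpow_mul_wr, genA_zpow, wr_mul_of_odd _ he, mul_one, mul_one,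
    zero_add]

theorem commute_genA_sq_wr (m : ℤ) (u v : Equiv.Perm (ℕ → ℤ)) :
    Commute (genA ^ (2 : ℤ)) (wr m u v) := by
  rw [genA_zpow, commute_iff_eq, wr_mul_of_even _ even_two]
  by_cases h : Even m
  · rw [wr_mul_of_even _ h, one_mul, one_mul, mul_one, mul_one, add_comm]
  · rw [wr_mul_of_odd _ h, one_mul, one_mul, mul_one, mul_one, add_comm]

theorem genA_mem : genA ∈ torsionFreeGroup :=
  Subgroup.subset_closure (Or.inl rfl)

theorem gen_mem (s : Letter) : gen s ∈ torsionFreeGroup := by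
  refine Subgroup.subset_closure ?_
  cases s <;> simp

theorem commute_genA_sq {g : Equiv.Perm (ℕ → ℤ)} (hg : g ∈ torsionFreeGroup) :
    Commute (genA ^ (2 : ℤ)) g := by
  have : torsionFreeGroup ≤ Subgroup.centralizer {genA ^ (2 : ℤ)} := by
    refine (Subgroup.closure_le _).2 ?_
    have h : ∀ s, gen s ∈ Subgroup.centralizer {genA ^ (2 : ℤ)} := fun s => by
      rw [Subgroup.mem_centralizer_singleton_iff, gen_eq_wr]
      exact (commute_genA_sq_wr _ _ _).symm.eq
    rintro g (rfl | rfl | rfl | rfl)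
    · rw [SetLike.mem_coe, Subgroup.mem_centralizer_singleton_iff]
      exact ((Commute.refl genA).zpow_right 2).eq
    all_goals exact h _
  exact (Subgroup.mem_centralizer_singleton_iff.1 (this hg)).symm

/-! ### Superpolynomial growth of Grigorchuk's group -/

section LowerBound

open scoped commutatorElement

/-- Every element of the group is the section, at odd first entries, of an element that fixes the
first entry. -/
theorem exists_wr_mem {h : Equiv.Perm (ℕ → ℤ)} (hh : h ∈ torsionFreeGroup) :
    ∃ p ∈ torsionFreeGroup, wr 0 p h ∈ torsionFreeGroup := by
  have hgen : ∀ s : Letter, ∃ p ∈ torsionFreeGroup, wr 0 p (gen s.next) ∈ torsionFreeGroup :=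
    fun s => ⟨_, zpow_mem genA_mem _, gen_eq_wr s ▸ gen_mem s⟩
  induction hh using Subgroup.closure_induction with
  | mem g hg =>
    rcases hg with rfl | rfl | rfl | rfl
    · refine ⟨gen .c, gen_mem _, ?_⟩
      have h1 : gen .b = wr 0 genA (gen .c) := by
        simpa [Letter.shift, Letter.next] using gen_eq_wr .b
      rw [← conj_genA_zpow_of_odd (e := 1) (by simp), ← h1]
      exact mul_mem (mul_mem (zpow_mem genA_mem 1) (gen_mem _)) (inv_mem (zpow_mem genA_mem 1))
    · exact hgen .d
    · exact hgen .b
    · exact hgen .c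
  | one => exact ⟨1, one_mem _, by rw [wr_one]; exact one_mem _⟩
  | mul x y _ _ hx hy =>
    obtain ⟨p, hp, hx⟩ := hx
    obtain ⟨q, hq, hy⟩ := hy
    exact ⟨p * q, mul_mem hp hq, by rw [← wr_zero_mul]; exact mul_mem hx hy⟩
  | inv x _ hx =>
    obtain ⟨p, hp, hx⟩ := hx
    exact ⟨p⁻¹, inv_mem hp, by rw [← wr_zero_inv]; exact inv_mem hx⟩

/-- The commutators of elements of the group with conjugates of the squares of `b`, `c`, `d`. -/
def squareCommutators : Set (Equiv.Perm (ℕ → ℤ)) :=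
  {z | ∃ h ∈ torsionFreeGroup, ∃ u ∈ torsionFreeGroup, ∃ s, z = ⁅h, u * gen s ^ 2 * u⁻¹⁆}

theorem squareCommutators_subset : squareCommutators ⊆ torsionFreeGroup := by
  rintro _ ⟨h, hh, u, hu, s, rfl⟩
  have : u * gen s ^ 2 * u⁻¹ ∈ torsionFreeGroup :=
    mul_mem (mul_mem hu (pow_mem (gen_mem s) 2)) (inv_mem hu)
  rw [commutatorElement_def]
  exact mul_mem (mul_mem (mul_mem hh this) (inv_mem hh)) (inv_mem this)

/-- The commutators can be moved into the odd section: the squares of `b`, `c`, `d` have a central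
section at even first entries, which disappears in the commutator. -/
theorem wr_odd_mem_squareCommutators {z : Equiv.Perm (ℕ → ℤ)} (hz : z ∈ squareCommutators) :
    wr 0 1 z ∈ squareCommutators := by
  obtain ⟨h, hh, u, hu, s, rfl⟩ := hz
  obtain ⟨p, hp, hph⟩ := exists_wr_mem hh
  obtain ⟨q, hq, hqu⟩ := exists_wr_mem hu
  obtain ⟨r, rfl⟩ : ∃ r : Letter, r.next = s := by
    cases s
    exacts [⟨.d, rfl⟩, ⟨.b, rfl⟩, ⟨.c, rfl⟩]
  refine ⟨_, hph, _, hqu, r, ?_⟩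
  have hcomm : ∀ g ∈ torsionFreeGroup, Commute ((genA ^ r.shift) ^ 2) g := fun g hg => by
    rw [← zpow_natCast, ← zpow_mul, mul_comm, zpow_mul]
    exact (commute_genA_sq hg).zpow_left _
  have h1 : q * (genA ^ r.shift) ^ 2 * q⁻¹ = (genA ^ r.shift) ^ 2 := by
    rw [(hcomm q hq).symm.eq, mul_inv_cancel_right]
  rw [gen_eq_wr r, wr_zero_pow, commutatorElement_def, commutatorElement_def]
  simp only [wr_zero_inv, wr_zero_mul]
  rw [h1, (hcomm p hp).symm.eq, mul_inv_cancel_right, mul_inv_cancel]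

theorem wr_even_mem_squareCommutators {z : Equiv.Perm (ℕ → ℤ)} (hz : z ∈ squareCommutators) :
    wr 0 z 1 ∈ squareCommutators := by
  obtain ⟨h, hh, u, hu, s, hz⟩ := wr_odd_mem_squareCommutators hz
  rw [← conj_genA_zpow_of_odd (e := 1) (by simp), hz, zpow_one]
  refine ⟨genA * h * genA⁻¹, mul_mem (mul_mem genA_mem hh) (inv_mem genA_mem), genA * u,
    mul_mem genA_mem hu, s, ?_⟩
  rw [commutatorElement_def, commutatorElement_def]
  group

theorem exists_squareCommutator_ne_one : ∃ z ∈ squareCommutators, z ≠ 1 := by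
  refine ⟨_, ⟨genA, genA_mem, 1, one_mem _, .b, rfl⟩, ?_⟩
  rw [one_mul, inv_one, mul_one, Ne, commutatorElement_eq_one_iff_mul_comm]
  intro h
  have hb : gen .b = wr 0 genA (gen .c) := by
    simpa [Letter.shift, Letter.next] using gen_eq_wr .b
  have hc : gen .c = wr 0 genA (gen .d) := by
    simpa [Letter.shift, Letter.next] using gen_eq_wr .c
  -- comparing sections reduces the relation to `genA ^ 2 = gen .c ^ 2`, and `gen .c` fixes the
  -- first entry
  have h1 : genA ^ (1 : ℤ) * gen .b ^ 2 = gen .b ^ 2 * genA ^ (1 : ℤ) := by rwa [zpow_one]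
  rw [hb, wr_zero_pow, genA_zpow_mul_wr, genA_zpow, wr_mul_of_odd _ (by simp), mul_one, mul_one,
    zero_add] at h1
  have h2 := (wr_injective h1).1
  rw [hc, wr_zero_pow, ← zpow_natCast, genA_zpow] at h2
  have h3 := congrFun (Equiv.congr_fun h2 0) 0
  simp [wr_apply_zero] at h3

/-- The product of powers of `z` with the given exponents, the `i`-th one acting on the sequences
that start with `i` odd entries followed by an even one. -/
def combProd (z : Equiv.Perm (ℕ → ℤ)) : List ℕ → Equiv.Perm (ℕ → ℤ)
  | [] => 1
  | n :: l => wr 0 (z ^ n) (combProd z l)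

theorem combProd_injective {z : Equiv.Perm (ℕ → ℤ)} (hz : Function.Injective fun n : ℕ => z ^ n)
    {l l' : List ℕ} (h : l.length = l'.length) (he : combProd z l = combProd z l') : l = l' := by
  induction l generalizing l' with
  | nil => exact (List.length_eq_zero_iff.1 h.symm).symm
  | cons n l ih =>
    cases l' with
    | nil => simp at h
    | cons n' l' =>
      obtain ⟨h1, h2⟩ := wr_injective he
      rw [hz h1, ih (by simpa using h) h2]

/-- The standard generators of Grigorchuk's group. -/
def generators : Set (Equiv.Perm (ℕ → ℤ)) := {genA, gen .b, gen .c, gen .d}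

theorem generators_finite : generators.Finite := by
  simp [generators]

theorem combProd_mem_wordBall {z : Equiv.Perm (ℕ → ℤ)} (hz : z ∈ squareCommutators) (r : ℕ) :
    ∃ N, ∀ n : ℕ, ∀ l : List ℕ, l.length = r → (∀ i ∈ l, i ≤ n) →
      combProd z l ∈ wordBall generators (N * n) := by
  have key : ∀ k : ℕ, ∃ N, ∀ n : ℕ, ∀ l : List ℕ, l.length = r → (∀ i ∈ l, i ≤ n) →
      (wr 0 1)^[k] (combProd z l) ∈ wordBall generators (N * n) := by
    induction r with
    | zero =>
      refine fun k => ⟨0, fun n l hl _ => ?_⟩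
      rw [List.length_eq_zero_iff.1 hl]
      have : (wr 0 1)^[k] (combProd z []) = 1 := Function.iterate_fixed wr_one k
      rw [this]
      exact one_mem_wordBall _ _
    | succ r ih =>
      intro k
      obtain ⟨N, hN⟩ := ih (k + 1)
      have hzk : (wr 0 1)^[k] (wr 0 z 1) ∈ squareCommutators :=
        Function.Iterate.rec _ (wr_even_mem_squareCommutators hz)
          (fun _ => wr_odd_mem_squareCommutators) k
      obtain ⟨M, hM⟩ := exists_mem_wordBall (squareCommutators_subset hzk)
      refine ⟨M + N, fun n l hl hln => ?_⟩
      cases l with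
      | nil => simp at hl
      | cons i l =>
        have hmul : ∀ (k : ℕ) (x y), (wr 0 1)^[k] (x * y) = (wr 0 1)^[k] x * (wr 0 1)^[k] y := by
          intro k
          induction k with
          | zero => exact fun _ _ => rfl
          | succ k ih =>
            intro x y
            rw [Function.iterate_succ_apply', ih, Function.iterate_succ_apply',
              Function.iterate_succ_apply', wr_zero_mul, one_mul]
        have hpow : ∀ (x) (n : ℕ), (wr 0 1)^[k] (x ^ n) = ((wr 0 1)^[k] x) ^ n := by
          intro x n
          induction n with
          | zero => exact Function.iterate_fixed wr_one k
          | succ n ih => rw [pow_succ, hmul, ih, pow_succ]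
        have e : combProd z (i :: l) = (wr 0 z 1) ^ i * wr 0 1 (combProd z l) := by
          rw [wr_zero_pow, wr_zero_mul, one_pow, mul_one, one_mul, combProd]
        rw [e, hmul, hpow, ← Function.iterate_succ_apply, add_mul]
        refine mul_mem_wordBall ?_ (hN n l (by simpa using hl) fun j hj => hln j (by simp [hj]))
        refine wordBall_mono_right _ ?_ (pow_mem_wordBall hM i)
        exact Nat.mul_le_mul_left M (hln i (by simp))
  exact key 0

theorem not_polynomiallyBounded : ¬ PolynomiallyBounded (groupGrowth generators) := by
  rintro ⟨C, d, hC⟩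
  obtain ⟨z, hz, hz1⟩ := exists_squareCommutator_ne_one
  have hinj : Function.Injective fun n : ℕ => z ^ n := by
    let z' : torsionFreeGroup := ⟨z, squareCommutators_subset hz⟩
    have h := injective_pow_iff_not_isOfFinOrder.2
      (not_isOfFinOrder z' fun h => hz1 (congrArg Subtype.val h))
    exact fun m n hmn => h (Subtype.ext hmn)
  obtain ⟨N, hN⟩ := combProd_mem_wordBall hz (d + 1)
  have hcard : ∀ n : ℕ, (n + 1) ^ (d + 1) ≤ groupGrowth generators (N * n) := by
    intro n
    let f : (Fin (d + 1) → Fin (n + 1)) → Equiv.Perm (ℕ → ℤ) := fun e =>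
      combProd z (List.ofFn fun i => (e i : ℕ))
    have hf : Function.Injective f := by
      intro e e' he
      have h1 := List.ofFn_injective (combProd_injective hinj (by simp) he)
      exact funext fun i => Fin.ext (congrFun h1 i)
    have hsub : Set.range f ⊆ wordBall generators (N * n) := by
      rintro _ ⟨e, rfl⟩
      refine hN n _ (by simp) fun i hi => ?_
      obtain ⟨j, rfl⟩ := List.mem_ofFn.1 hi
      exact Nat.lt_succ_iff.1 (e j).2
    have h1 := Set.ncard_le_ncard hsub (wordBall_finite generators_finite _)
    rwa [← Set.image_univ, Set.ncard_image_of_injective _ hf, Set.ncard_univ,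
      Nat.card_eq_fintype_card, Fintype.card_fun, Fintype.card_fin, Fintype.card_fin] at h1
  have hle : ∀ n : ℕ, n + 1 ≤ C * (N + 1) ^ d := by
    intro n
    have h1 : (n + 1) ^ (d + 1) ≤ C * (N + 1) ^ d * (n + 1) ^ d := by
      refine (hcard n).trans ((hC _).trans ?_)
      rw [mul_assoc, ← mul_pow]
      gcongr
      nlinarith
    rw [pow_succ, mul_comm] at h1
    exact Nat.le_of_mul_le_mul_right h1 (by positivity)
  exact absurd (hle (C * (N + 1) ^ d)) (by omega)

end LowerBound

end Grigorchuk

/-! ### Contraction in Grigorchuk's group -/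

namespace Grigorchuk

section Contraction

theorem commute_gen (s s' : Letter) : Commute (gen s) (gen s') := by
  have key : ∀ n : ℕ, ∀ s s' l, gen s (gen s' l) n = gen s' (gen s l) n := by
    intro n
    induction n with
    | zero => exact fun _ _ _ => rfl
    | succ n ih =>
      intro s s' l
      have h := fun s s' : Letter => congrArg (fun g : Equiv.Perm (ℕ → ℤ) => g l (n + 1))
        (wr_zero_mul (genA ^ s.shift) (gen s.next) (genA ^ s'.shift) (gen s'.next))
      simp only [← gen_eq_wr, wr_apply_succ] at h
      have e : genA ^ s.shift * genA ^ s'.shift = genA ^ s'.shift * genA ^ s.shift :=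
        (Commute.zpow_zpow_self genA _ _).eq
      change (gen s * gen s') l (n + 1) = (gen s' * gen s) l (n + 1)
      rw [h, h, e]
      split_ifs
      · rfl
      · exact ih _ _ _
  exact Equiv.ext fun l => funext fun n => key n s s' l

/-- The element `b ^ i * c ^ j * d ^ k`. -/
def syl (x : ℤ × ℤ × ℤ) : Equiv.Perm (ℕ → ℤ) :=
  gen .b ^ x.1 * gen .c ^ x.2.1 * gen .d ^ x.2.2

theorem syl_zero : syl 0 = 1 := by
  simp [syl]

theorem syl_add (x y : ℤ × ℤ × ℤ) : syl (x + y) = syl x * syl y := by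
  have h1 := ((commute_gen .c .b).zpow_zpow x.2.1 y.1).eq
  have h2 := ((commute_gen .d .b).zpow_zpow x.2.2 y.1).eq
  have h3 := ((commute_gen .d .c).zpow_zpow x.2.2 y.2.1).eq
  simp only [syl, Prod.fst_add, Prod.snd_add, zpow_add]
  generalize gen .b ^ x.1 = b, gen .b ^ y.1 = b', gen .c ^ x.2.1 = c, gen .c ^ y.2.1 = c',
    gen .d ^ x.2.2 = d, gen .d ^ y.2.2 = d' at *
  calc b * b' * (c * c') * (d * d') = b * (b' * c) * (c' * d) * d' := by group
    _ = b * (c * b') * (d * c') * d' := by rw [h1, h3]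
    _ = b * c * (b' * d) * c' * d' := by group
    _ = b * c * d * (b' * c' * d') := by rw [← h2]; group

/-- The exponent of `a` in the section of `syl x` at even first entries. -/
def sylShift (x : ℤ × ℤ × ℤ) : ℤ := x.1 + x.2.1

/-- The exponents of the section of `syl x` at odd first entries. -/
def sylNext (x : ℤ × ℤ × ℤ) : ℤ × ℤ × ℤ := (x.2.2, x.1, x.2.1)

theorem syl_eq_wr (x : ℤ × ℤ × ℤ) : syl x = wr 0 (genA ^ sylShift x) (syl (sylNext x)) := by
  have h1 := ((commute_gen .c .b).zpow_zpow x.1 x.2.2).eq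
  have h2 := ((commute_gen .d .b).zpow_zpow x.2.1 x.2.2).eq
  rw [syl, gen_eq_wr .b, gen_eq_wr .c, gen_eq_wr .d, wr_zero_zpow, wr_zero_zpow, wr_zero_zpow,
    wr_zero_mul, wr_zero_mul]
  simp only [Letter.shift, Letter.next, zpow_one, zpow_zero, one_zpow, mul_one]
  rw [← zpow_add, mul_assoc, h2, ← mul_assoc, h1]
  rfl

/-- The parity of an integer, as a natural number. -/
def par (m : ℤ) : ℕ := (m % 2).toNat

/-- The weight of an element of `⟨b, c, d⟩`. It depends only on the class in Klein's four-group,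
where `b * c * d` and the squares become trivial: the classes of `b`, `c`, `d` and `1` have the
weights `5`, `3`, `2` and `0`. Together with the weight `5` of a letter `a`, these numbers satisfy
the contraction inequality `contraction`. -/
def sylWeight (x : ℤ × ℤ × ℤ) : ℕ :=
  if (x.1 - x.2.1) % 2 = 0 then if (x.2.1 - x.2.2) % 2 = 0 then 0 else 2
  else if (x.2.1 - x.2.2) % 2 = 0 then 5 else 3

/-- The total exponent. -/
def sylNorm (x : ℤ × ℤ × ℤ) : ℕ := x.1.natAbs + x.2.1.natAbs + x.2.2.natAbs

theorem sylWeight_add (x y : ℤ × ℤ × ℤ) : sylWeight (x + y) ≤ sylWeight x + sylWeight y := by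
  simp only [sylWeight, Prod.fst_add, Prod.snd_add]
  split_ifs <;> omega

theorem sylNorm_add (x y : ℤ × ℤ × ℤ) : sylNorm (x + y) ≤ sylNorm x + sylNorm y := by
  simp only [sylNorm, Prod.fst_add, Prod.snd_add]
  omega

/-- Both sections of a letter together weigh at most `7 / 8` of the letter and the `a` next to
it. -/
theorem contraction (x : ℤ × ℤ × ℤ) :
    8 * (5 * par (sylShift x) + sylWeight (sylNext x)) ≤ 7 * (5 + sylWeight x) := by
  obtain ⟨i, j, k⟩ := x
  simp only [sylWeight, sylShift, sylNext, par]
  by_cases h1 : (i - j) % 2 = 0 <;> by_cases h2 : (j - k) % 2 = 0 <;>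
    by_cases h3 : (k - i) % 2 = 0 <;> simp only [h1, h2, h3, if_true, if_false] <;> omega

theorem natAbs_sylShift_le (x : ℤ × ℤ × ℤ) : (sylShift x).natAbs ≤ sylNorm x := by
  simp only [sylShift, sylNorm]
  omega

theorem sylNorm_sylNext (x : ℤ × ℤ × ℤ) : sylNorm (sylNext x) = sylNorm x := by
  simp only [sylNext, sylNorm]
  omega

/-- The product of elements of `⟨b, c, d⟩` that are alternatingly conjugated by `a` or not; the
parity of `e` tells whether the first one is conjugated. -/
def altProd : ℤ → List (ℤ × ℤ × ℤ) → Equiv.Perm (ℕ → ℤ)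
  | _, [] => 1
  | e, x :: L => genA ^ e * syl x * (genA ^ e)⁻¹ * altProd (e + 1) L

/-- The total weight of a list of syllables, each of which comes with one letter `a`. -/
def listWeight (L : List (ℤ × ℤ × ℤ)) : ℕ := (L.map fun x => 5 + sylWeight x).sum

/-- The total exponent of a list of syllables. -/
def listNorm (L : List (ℤ × ℤ × ℤ)) : ℕ := (L.map sylNorm).sum

mutual
/-- The section of an alternating product that begins with a power of `a`. -/
def sectionA : List (ℤ × ℤ × ℤ) → Equiv.Perm (ℕ → ℤ)
  | [] => 1
  | x :: L => genA ^ sylShift x * sectionX L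
/-- The section of an alternating product that begins with an element of `⟨b, c, d⟩`. -/
def sectionX : List (ℤ × ℤ × ℤ) → Equiv.Perm (ℕ → ℤ)
  | [] => 1
  | x :: L => syl (sylNext x) * sectionA L
end

mutual
/-- The weight of `sectionA L` before merging of syllables. -/
def costA : List (ℤ × ℤ × ℤ) → ℕ
  | [] => 0
  | x :: L => 5 * par (sylShift x) + costX L
/-- The weight of `sectionX L` before merging of syllables. -/
def costX : List (ℤ × ℤ × ℤ) → ℕ
  | [] => 0
  | x :: L => sylWeight (sylNext x) + costA L
end

theorem costA_add_costX (L : List (ℤ × ℤ × ℤ)) : 8 * (costA L + costX L) ≤ 7 * listWeight L := by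
  induction L with
  | nil => simp [costA, costX, listWeight]
  | cons x L ih =>
    have := contraction x
    simp only [costA, costX, listWeight, List.map_cons, List.sum_cons] at ih ⊢
    omega

theorem altProd_eq_wr (e : ℤ) (L : List (ℤ × ℤ × ℤ)) : altProd e L =
    if Even e then wr 0 (sectionA L) (sectionX L) else wr 0 (sectionX L) (sectionA L) := by
  induction L generalizing e with
  | nil => simp [altProd, sectionA, sectionX, wr_one]
  | cons x L ih =>
    rw [altProd, ih, syl_eq_wr]
    by_cases he : Even e
    · have he' : ¬ Even (e + 1) := by simpa [Int.even_add_one] using he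
      rw [if_pos he, if_neg he', conj_genA_zpow_of_even he, wr_zero_mul, sectionA, sectionX]
    · have he' : Even (e + 1) := by simpa [Int.even_add_one] using he
      rw [if_neg he, if_pos he', conj_genA_zpow_of_odd he, wr_zero_mul, sectionA, sectionX]

/-- `g` has a normal form `a ^ m * altProd e L` of weight at most `w` and total exponent at
most `N`. The weight is increased by `5` if the next syllable cannot be merged with the first syllable
of `L`. -/
def HasNormalForm (g : Equiv.Perm (ℕ → ℤ)) (w N : ℕ) : Prop :=
  ∃ (m e : ℤ) (x : ℤ × ℤ × ℤ) (L : List (ℤ × ℤ × ℤ)), g = genA ^ m * altProd e (x :: L) ∧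
    listWeight (x :: L) + 5 * par (m - e) ≤ w ∧ m.natAbs + listNorm (x :: L) ≤ N

theorem HasNormalForm.mono {g : Equiv.Perm (ℕ → ℤ)} {w N w' N' : ℕ} (h : HasNormalForm g w N)
    (hw : w ≤ w') (hN : N ≤ N') : HasNormalForm g w' N' := by
  obtain ⟨m, e, x, L, hg, h1, h2⟩ := h
  exact ⟨m, e, x, L, hg, h1.trans hw, h2.trans hN⟩

theorem hasNormalForm_one : HasNormalForm 1 5 0 := by
  refine ⟨0, 0, 0, [], ?_, ?_, ?_⟩
  · simp [altProd, syl_zero]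
  · simp [listWeight, sylWeight, par]
  · simp [listNorm, sylNorm]

theorem HasNormalForm.genA_zpow_mul {g : Equiv.Perm (ℕ → ℤ)} {w N : ℕ} (h : HasNormalForm g w N)
    (s : ℤ) : HasNormalForm (genA ^ s * g) (w + 5 * par s) (N + s.natAbs) := by
  obtain ⟨m, e, x, L, rfl, h1, h2⟩ := h
  refine ⟨s + m, e, x, L, ?_, ?_, ?_⟩
  · rw [zpow_add, mul_assoc]
  · simp only [par] at h1 ⊢
    omega
  · omega

theorem conj_syl_eq {m e : ℤ} (h : Even m ↔ Even e) (y : ℤ × ℤ × ℤ) :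
    genA ^ m * syl y * (genA ^ m)⁻¹ = genA ^ e * syl y * (genA ^ e)⁻¹ := by
  rw [syl_eq_wr]
  by_cases he : Even e
  · rw [conj_genA_zpow_of_even he, conj_genA_zpow_of_even (h.2 he)]
  · rw [conj_genA_zpow_of_odd he, conj_genA_zpow_of_odd (fun hm => he (h.1 hm))]

theorem syl_mul_genA_zpow_mul (y : ℤ × ℤ × ℤ) (m : ℤ) (g : Equiv.Perm (ℕ → ℤ)) :
    syl y * (genA ^ m * g) = genA ^ m * (genA ^ m * syl y * (genA ^ m)⁻¹ * g) := by
  rw [conj_syl_eq (e := -m) (by simp)]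
  group

theorem HasNormalForm.syl_mul {g : Equiv.Perm (ℕ → ℤ)} {w N : ℕ} (h : HasNormalForm g w N)
    (y : ℤ × ℤ × ℤ) : HasNormalForm (syl y * g) (w + sylWeight y) (N + sylNorm y) := by
  obtain ⟨m, e, x, L, rfl, h1, h2⟩ := h
  rw [syl_mul_genA_zpow_mul]
  by_cases hme : (m - e) % 2 = 0
  · -- the syllable is merged with the first one
    have heven : Even m ↔ Even e := by
      rw [Int.even_iff, Int.even_iff]
      omega
    refine ⟨m, e, y + x, L, ?_, ?_, ?_⟩
    · rw [altProd, altProd, conj_syl_eq heven, syl_add]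
      group
    · have := sylWeight_add y x
      simp only [listWeight, List.map_cons, List.sum_cons, par] at h1 ⊢
      omega
    · have := sylNorm_add y x
      simp only [listNorm, List.map_cons, List.sum_cons] at h2 ⊢
      omega
  · have heven : Even m ↔ Even (e - 1) := by
      rw [Int.even_iff, Int.even_iff]
      omega
    refine ⟨m, e - 1, y, x :: L, ?_, ?_, ?_⟩
    · rw [conj_syl_eq heven]
      conv_rhs => rw [altProd, sub_add_cancel]
    · simp only [listWeight, List.map_cons, List.sum_cons, par] at h1 ⊢
      omega
    · simp only [listNorm, List.map_cons, List.sum_cons] at h2 ⊢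
      omega

theorem hasNormalForm_section (L : List (ℤ × ℤ × ℤ)) :
    HasNormalForm (sectionA L) (5 + costA L) (listNorm L) ∧
      HasNormalForm (sectionX L) (5 + costX L) (listNorm L) := by
  induction L with
  | nil => exact ⟨hasNormalForm_one, hasNormalForm_one⟩
  | cons x L ih =>
    have h1 := natAbs_sylShift_le x
    have h2 := sylNorm_sylNext x
    refine ⟨(ih.2.genA_zpow_mul (sylShift x)).mono ?_ ?_, (ih.1.syl_mul (sylNext x)).mono ?_ ?_⟩
    · rw [costA]
      omega
    · simp only [listNorm, List.map_cons, List.sum_cons]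
      omega
    · rw [costX]
      omega
    · simp only [listNorm, List.map_cons, List.sum_cons]
      omega

/-- An element of weight `w` has two sections of total weight at most `7 / 8 * w + 10`. -/
theorem HasNormalForm.exists_sections {g : Equiv.Perm (ℕ → ℤ)} {w N : ℕ}
    (h : HasNormalForm g w N) : ∃ m : ℤ, m.natAbs ≤ N ∧ ∃ w₁ ≤ 10 + 7 * w / 8, ∃ u v,
      HasNormalForm u w₁ N ∧ HasNormalForm v (10 + 7 * w / 8 - w₁) N ∧ g = wr m u v := by
  obtain ⟨m, e, x, L, rfl, h1, h2⟩ := h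
  have hc := costA_add_costX (x :: L)
  obtain ⟨hA, hX⟩ := hasNormalForm_section (x :: L)
  refine ⟨m, by omega, ?_⟩
  rw [altProd_eq_wr]
  split_ifs
  · exact ⟨5 + costA (x :: L), by omega, _, _, hA.mono le_rfl (by omega),
      hX.mono (by omega) (by omega), genA_zpow_mul_wr _ _ _⟩
  · exact ⟨5 + costX (x :: L), by omega, _, _, hX.mono le_rfl (by omega),
      hA.mono (by omega) (by omega), genA_zpow_mul_wr _ _ _⟩

theorem hasNormalForm_of_mem_wordBall {n : ℕ} {g : Equiv.Perm (ℕ → ℤ)}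
    (hg : g ∈ wordBall generators n) : HasNormalForm g (5 * n + 5) n := by
  induction n generalizing g with
  | zero =>
    rw [wordBall_zero] at hg
    rw [Set.mem_singleton_iff.1 hg]
    exact hasNormalForm_one
  | succ n ih =>
    rw [add_comm, wordBall_add, wordBall_one] at hg
    obtain ⟨s, hs, g, hg, rfl⟩ := hg
    have h := ih hg
    have hA : ∀ e : ℤ, e.natAbs ≤ 1 → HasNormalForm (genA ^ e * g) (5 * (n + 1) + 5) (n + 1) :=
      fun e he => (h.genA_zpow_mul e).mono (by simp only [par]; omega) (by omega)
    have hX : ∀ x, sylNorm x ≤ 1 → HasNormalForm (syl x * g) (5 * (n + 1) + 5) (n + 1) :=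
      fun x hx => (h.syl_mul x).mono (by simp only [sylWeight]; split_ifs <;> omega) (by omega)
    have hb : ∀ e, syl (e, 0, 0) = gen .b ^ e := fun e => by simp [syl]
    have hc : ∀ e, syl (0, e, 0) = gen .c ^ e := fun e => by simp [syl]
    have hd : ∀ e, syl (0, 0, e) = gen .d ^ e := fun e => by simp [syl]
    change HasNormalForm (s * g) _ _
    rcases hs with (hs | hs) | hs
    · rw [Set.mem_singleton_iff.1 hs, one_mul]
      exact h.mono (by omega) (by omega)
    · rcases hs with rfl | rfl | rfl | rfl
      · simpa using hA 1 (by simp)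
      · simpa [hb] using hX (1, 0, 0) (by simp [sylNorm])
      · simpa [hc] using hX (0, 1, 0) (by simp [sylNorm])
      · simpa [hd] using hX (0, 0, 1) (by simp [sylNorm])
    · rcases hs with hs | hs | hs | hs <;> rw [← inv_inv s, hs]
      · simpa using hA (-1) (by simp)
      · simpa [hb] using hX (-1, 0, 0) (by simp [sylNorm])
      · simpa [hc] using hX (0, -1, 0) (by simp [sylNorm])
      · simpa [hd] using hX (0, 0, -1) (by simp [sylNorm])

end Contraction

end Grigorchuk

/-! ### Subexponential growth of Grigorchuk's group -/

namespace Grigorchuk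

section UpperBound

open scoped Pointwise
open Filter Topology

/-- The elements with a normal form of weight at most `w` and total exponent at most `N`. -/
def normalFormSet (w N : ℕ) : Set (Equiv.Perm (ℕ → ℤ)) := {g | HasNormalForm g w N}

/-- The number of syllables with exponents bounded by `N`, with or without conjugation by `a`. -/
def sylCount (N : ℕ) : ℕ := 2 * (2 * N + 1) ^ 3

theorem two_mul_add_one_le_sylCount (N : ℕ) : 2 * N + 1 ≤ sylCount N := by
  have : (2 * N + 1) ^ 1 ≤ (2 * N + 1) ^ 3 := Nat.pow_le_pow_right (by omega) (by omega)
  rw [pow_one] at this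
  rw [sylCount]
  omega

theorem ncard_Icc_neg (N : ℕ) : (Set.Icc (-N : ℤ) N).ncard = 2 * N + 1 := by
  rw [← Finset.coe_Icc, Set.ncard_coe_finset, Int.card_Icc]
  omega

theorem finite_normalFormSet_and_ncard_le (w N : ℕ) : (normalFormSet w N).Finite ∧
    (normalFormSet w N).ncard ≤ sylCount N ^ (w + 1) := by
  let I : Set ℤ := Set.Icc (-N) N
  have hI : I.Finite := Set.finite_Icc _ _
  let B : Set (ℤ × ℤ × ℤ × ℤ) := ({0, 1} : Set ℤ) ×ˢ I ×ˢ I ×ˢ I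
  have hB : B.Finite := (Set.toFinite _).prod (hI.prod (hI.prod hI))
  let f : ℤ × ℤ × ℤ × ℤ → Equiv.Perm (ℕ → ℤ) := fun p => genA ^ p.1 * syl p.2 * (genA ^ p.1)⁻¹
  let W : Set (Equiv.Perm (ℕ → ℤ)) := f '' B
  have hW : W.Finite := hB.image f
  have hWcard : W.ncard ≤ sylCount N := by
    refine (Set.ncard_image_le hB).trans (le_of_eq ?_)
    rw [Set.ncard_prod, Set.ncard_prod, Set.ncard_prod, ncard_Icc_neg,
      Set.ncard_pair (by norm_num), sylCount]
    ring
  have h1W : (1 : Equiv.Perm (ℕ → ℤ)) ∈ W :=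
    ⟨(0, 0, 0, 0), ⟨by simp, by simp [I], by simp [I], by simp [I]⟩, by
      change genA ^ (0 : ℤ) * syl 0 * (genA ^ (0 : ℤ))⁻¹ = 1
      rw [syl_zero, mul_one, mul_inv_cancel]⟩
  have hWn : ∀ n, (W ^ n).Finite := by
    intro n
    induction n with
    | zero => simp [← Set.singleton_one]
    | succ n ih =>
      rw [pow_succ]
      exact ih.mul hW
  have halt : ∀ (L : List (ℤ × ℤ × ℤ)) (e : ℤ), listNorm L ≤ N → altProd e L ∈ W ^ L.length := by
    intro L
    induction L with
    | nil => exact fun _ _ => by simp [altProd]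
    | cons x L ih =>
      intro e hL
      simp only [listNorm, List.map_cons, List.sum_cons] at hL ih
      rw [altProd, List.length_cons, pow_succ']
      refine Set.mul_mem_mul ⟨(e % 2, x), ⟨?_, ?_⟩, ?_⟩ (ih _ (by omega))
      · exact Int.emod_two_eq e
      · simp only [sylNorm] at hL
        simp only [I, Set.mem_prod, Set.mem_Icc]
        omega
      · refine conj_syl_eq ?_ x
        rw [Int.even_iff, Int.even_iff]
        omega
  let T := Set.image2 (fun (m : ℤ) g => genA ^ m * g) I (W ^ w)
  have hsub : normalFormSet w N ⊆ T := by
    rintro _ ⟨m, e, x, L, rfl, h1, h2⟩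
    refine ⟨m, ?_, altProd e (x :: L), ?_, rfl⟩
    · simp only [I, Set.mem_Icc]
      omega
    · refine Set.pow_subset_pow_right h1W ?_ (halt (x :: L) e (by omega))
      have : ∀ L : List (ℤ × ℤ × ℤ), L.length ≤ listWeight L := by
        intro L
        induction L with
        | nil => simp
        | cons y L ih =>
          simp only [listWeight, List.map_cons, List.sum_cons, List.length_cons] at ih ⊢
          omega
      have := this (x :: L)
      omega
  have hT : T.Finite := hI.image2 _ (hWn w)
  refine ⟨hT.subset hsub, (Set.ncard_le_ncard hsub hT).trans ?_⟩
  have h1 : T.ncard ≤ I.ncard * (W ^ w).ncard := by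
    simp only [T]
    rw [← Set.image_prod, ← Set.ncard_prod]
    exact Set.ncard_image_le (hI.prod (hWn w))
  refine h1.trans ?_
  rw [pow_succ', ncard_Icc_neg]
  exact Nat.mul_le_mul (two_mul_add_one_le_sylCount N)
    ((ncard_pow_le W w).trans (Nat.pow_le_pow_left hWcard w))

/-- An element is determined by its two sections and its action on the first entry, so a bound for
the number of elements improves by contraction. -/
theorem ncard_normalFormSet_step {N : ℕ} (hN : 80 ≤ N) {α β : ℝ} (hα : 0 ≤ α)
    (h : ∀ w ≤ N, ((normalFormSet w N).ncard : ℝ) ≤ (sylCount N : ℝ) ^ (α * w + β))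
    {w : ℕ} (hw : w ≤ N) :
    ((normalFormSet w N).ncard : ℝ) ≤
      (sylCount N : ℝ) ^ (7 / 8 * α * w + (10 * α + 2 * β + 2)) := by
  set Q : ℝ := (sylCount N : ℝ) with hQ
  have hNQ : (2 * N + 1 : ℝ) ≤ Q := by
    rw [hQ]
    exact_mod_cast two_mul_add_one_le_sylCount N
  have hN' : (80 : ℝ) ≤ N := by exact_mod_cast hN
  have hQ1 : 1 ≤ Q := by linarith
  have hQ0 : 0 < Q := by linarith
  let M := 10 + 7 * w / 8
  have hMN : M ≤ N := by omega
  have hMw : (M : ℝ) ≤ 10 + 7 / 8 * w := by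
    have : 8 * M ≤ 80 + 7 * w := by omega
    have : (8 * M : ℝ) ≤ 80 + 7 * w := by exact_mod_cast this
    linarith
  let J : Finset (ℤ × ℕ) := Finset.Icc (-N : ℤ) N ×ˢ Finset.range (M + 1)
  let E : ℤ × ℕ → Set (Equiv.Perm (ℕ → ℤ)) := fun p =>
    (fun q : Equiv.Perm (ℕ → ℤ) × Equiv.Perm (ℕ → ℤ) => wr p.1 q.1 q.2) ''
      (normalFormSet p.2 N ×ˢ normalFormSet (M - p.2) N)
  have hfin : ∀ w, (normalFormSet w N).Finite := fun w => (finite_normalFormSet_and_ncard_le w N).1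
  have hE : ∀ p, (E p).Finite := fun p => ((hfin _).prod (hfin _)).image _
  have hsub : normalFormSet w N ⊆ ⋃ p ∈ J, E p := by
    intro g hg
    obtain ⟨m, hm, w₁, hw₁, u, v, hu, hv, rfl⟩ := HasNormalForm.exists_sections hg
    refine Set.mem_biUnion (x := (m, w₁)) ?_ ⟨(u, v), ⟨hu, hv⟩, rfl⟩
    simp only [J, Finset.coe_product, Set.mem_prod, Finset.coe_Icc, Set.mem_Icc, Finset.coe_range,
      Set.mem_Iio]
    omega
  have hcard : (normalFormSet w N).ncard ≤ ∑ p ∈ J, (E p).ncard :=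
    (Set.ncard_le_ncard hsub (Set.Finite.biUnion (Finset.finite_toSet J) fun p _ => hE p)).trans
      (Finset.set_ncard_biUnion_le J E)
  have hEcard : ∀ p ∈ J, ((E p).ncard : ℝ) ≤ Q ^ (α * M + 2 * β) := by
    intro p hp
    have hpM : p.2 ≤ M := by
      have := (Finset.mem_product.1 hp).2
      rw [Finset.mem_range] at this
      omega
    have h1 : (E p).ncard ≤ (normalFormSet p.2 N).ncard * (normalFormSet (M - p.2) N).ncard := by
      rw [← Set.ncard_prod]
      exact Set.ncard_image_le ((hfin _).prod (hfin _))
    calc ((E p).ncard : ℝ)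
        ≤ (normalFormSet p.2 N).ncard * (normalFormSet (M - p.2) N).ncard := by exact_mod_cast h1
      _ ≤ Q ^ (α * p.2 + β) * Q ^ (α * (M - p.2 : ℕ) + β) := by
          gcongr
          · exact h _ (by omega)
          · exact h _ (by omega)
      _ = Q ^ (α * M + 2 * β) := by
          rw [← Real.rpow_add hQ0, Nat.cast_sub hpM]
          congr 1
          ring
  have hJ : (J.card : ℝ) ≤ Q ^ (2 : ℝ) := by
    have : J.card = (2 * N + 1) * (M + 1) := by
      rw [Finset.card_product, Int.card_Icc, Finset.card_range]
      congr 1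
      omega
    have hM1 : ((M : ℝ) + 1) ≤ Q := by
      have : (M : ℝ) ≤ N := by exact_mod_cast hMN
      linarith
    rw [this, Real.rpow_two, pow_two]
    push_cast
    gcongr
  calc ((normalFormSet w N).ncard : ℝ) ≤ ∑ p ∈ J, ((E p).ncard : ℝ) := by exact_mod_cast hcard
    _ ≤ ∑ p ∈ J, Q ^ (α * M + 2 * β) := Finset.sum_le_sum hEcard
    _ = J.card * Q ^ (α * M + 2 * β) := by rw [Finset.sum_const, nsmul_eq_mul]
    _ ≤ Q ^ (2 : ℝ) * Q ^ (α * M + 2 * β) := by gcongr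
    _ = Q ^ (α * M + 2 * β + 2) := by
        rw [← Real.rpow_add hQ0]
        congr 1
        ring
    _ ≤ Q ^ (7 / 8 * α * w + (10 * α + 2 * β + 2)) := by
        refine Real.rpow_le_rpow_of_exponent_le hQ1 ?_
        nlinarith [mul_le_mul_of_nonneg_left hMw hα]

theorem ncard_normalFormSet_le {N : ℕ} (hN : 80 ≤ N) (k : ℕ) {w : ℕ} (hw : w ≤ N) :
    ((normalFormSet w N).ncard : ℝ) ≤
      (sylCount N : ℝ) ^ ((7 / 8 : ℝ) ^ k * w + (13 * 2 ^ k - 12)) := by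
  have hQ1 : (1 : ℝ) ≤ sylCount N := by
    have := two_mul_add_one_le_sylCount N
    exact_mod_cast (by omega : 1 ≤ sylCount N)
  induction k generalizing w with
  | zero =>
    have h := (finite_normalFormSet_and_ncard_le w N).2
    have e : (7 / 8 : ℝ) ^ 0 * w + (13 * 2 ^ 0 - 12) = ((w + 1 : ℕ) : ℝ) := by
      push_cast
      ring
    rw [e, Real.rpow_natCast]
    exact_mod_cast h
  | succ k ih =>
    refine (ncard_normalFormSet_step hN (by positivity) (fun w hw => ih hw) hw).trans ?_
    refine Real.rpow_le_rpow_of_exponent_le hQ1 ?_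
    have : (7 / 8 : ℝ) ^ k ≤ 1 := pow_le_one₀ (by norm_num) (by norm_num)
    rw [pow_succ, pow_succ]
    linarith

theorem not_exponentiallyGrowing : ¬ ExponentiallyGrowing (groupGrowth generators) := by
  rintro ⟨c, hc, hgrowth⟩
  have hlogc : 0 < Real.log c := Real.log_pos hc
  -- the growth function at `4 ^ k`, estimated with `k` levels of sections
  have key : ∀ k : ℕ, Real.log c ≤
      23 * Real.log 4 * (3 * (k * (7 / 8 : ℝ) ^ k) + 15 * (7 / 8 : ℝ) ^ k) := by
    intro k
    set n := 4 ^ k with hn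
    have hn1 : 1 ≤ n := Nat.one_le_pow _ _ (by norm_num)
    let N := 5 * n + 80
    set Q : ℝ := (sylCount N : ℝ) with hQ
    have hQ1 : (1 : ℝ) ≤ Q := by
      have := two_mul_add_one_le_sylCount N
      rw [hQ]
      exact_mod_cast (by omega : 1 ≤ sylCount N)
    have hball : wordBall generators n ⊆ normalFormSet (5 * n + 5) N := fun g hg =>
      (hasNormalForm_of_mem_wordBall hg).mono le_rfl (by omega)
    have h1 : groupGrowth generators n ≤ (normalFormSet (5 * n + 5) N).ncard :=
      Set.ncard_le_ncard hball (finite_normalFormSet_and_ncard_le _ _).1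
    have h2 : c ^ n ≤ Q ^ ((7 / 8 : ℝ) ^ k * (5 * n + 5 : ℕ) + (13 * 2 ^ k - 12)) :=
      (hgrowth n).trans ((by exact_mod_cast h1 :
        (groupGrowth generators n : ℝ) ≤ (normalFormSet (5 * n + 5) N).ncard).trans
        (ncard_normalFormSet_le (by omega) k (by omega)))
    have h3 := Real.log_le_log (by positivity) h2
    rw [Real.log_pow, Real.log_rpow (by linarith)] at h3
    have hlogQ : Real.log Q ≤ (3 * k + 15 : ℕ) * Real.log 4 := by
      rw [← Real.log_pow]
      refine Real.log_le_log (by linarith) ?_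
      have : sylCount N ≤ 4 ^ (3 * k + 15) := by
        have e : 4 ^ (3 * k + 15) = (n * 1024) ^ 3 := by
          rw [hn, mul_pow, ← pow_mul, pow_add, mul_comm k 3]
          norm_num
        have h4 : 2 * N + 1 ≤ n * 171 := by omega
        rw [e, sylCount]
        calc 2 * (2 * N + 1) ^ 3 ≤ 2 * (n * 171) ^ 3 := by gcongr
          _ ≤ (n * 1024) ^ 3 := by
            rw [mul_pow, mul_pow]
            nlinarith [Nat.zero_le (n ^ 3)]
      rw [hQ]
      exact_mod_cast this
    have hn4 : (n : ℝ) = 4 ^ k := by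
      rw [hn]
      push_cast
      rfl
    have hexp : (7 / 8 : ℝ) ^ k * (5 * n + 5 : ℕ) + (13 * 2 ^ k - 12) ≤
        23 * (7 / 8 : ℝ) ^ k * n := by
      have h5 : (2 : ℝ) ^ k ≤ (7 / 8 : ℝ) ^ k * n := by
        rw [hn4, ← mul_pow]
        gcongr
        norm_num
      have h6 : (1 : ℝ) ≤ n := by exact_mod_cast hn1
      have h7 : (0 : ℝ) < (7 / 8 : ℝ) ^ k := by positivity
      push_cast
      nlinarith
    have hn0 : (0 : ℝ) < n := by exact_mod_cast hn1
    have h8 : n * Real.log c ≤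
        n * (23 * Real.log 4 * (3 * (k * (7 / 8 : ℝ) ^ k) + 15 * (7 / 8 : ℝ) ^ k)) := by
      refine h3.trans ((mul_le_mul hexp hlogQ (Real.log_nonneg hQ1) (by positivity)).trans
        (le_of_eq ?_))
      push_cast
      ring
    exact le_of_mul_le_mul_left h8 hn0
  have hlim : Tendsto (fun k : ℕ =>
      23 * Real.log 4 * (3 * (k * (7 / 8 : ℝ) ^ k) + 15 * (7 / 8 : ℝ) ^ k)) atTop (𝓝 0) := by
    have h1 : Tendsto (fun k : ℕ => (k : ℝ) * (7 / 8 : ℝ) ^ k) atTop (𝓝 0) :=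
      tendsto_self_mul_const_pow_of_lt_one (by norm_num) (by norm_num)
    have h2 : Tendsto (fun k : ℕ => (7 / 8 : ℝ) ^ k) atTop (𝓝 0) :=
      tendsto_pow_atTop_nhds_zero_of_lt_one (by norm_num) (by norm_num)
    simpa using ((h1.const_mul 3).add (h2.const_mul 15)).const_mul (23 * Real.log 4)
  exact absurd (ge_of_tendsto' hlim key) (not_le.2 hlogc)

theorem hasIntermediateGrowth : HasIntermediateGrowth torsionFreeGroup := by
  let ι := torsionFreeGroup.subtype
  let S : Set torsionFreeGroup := ι ⁻¹' generators
  have hS : ι '' S = generators := by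
    rw [Set.image_preimage_eq_iff]
    intro g hg
    exact ⟨⟨g, Subgroup.subset_closure hg⟩, rfl⟩
  have hgrowth : groupGrowth S = groupGrowth generators := by
    rw [← hS]
    exact (funext (groupGrowth_image_of_injective ι torsionFreeGroup.subtype_injective)).symm
  refine ⟨S, generators_finite.preimage torsionFreeGroup.subtype_injective.injOn, ?_, ?_, ?_⟩
  · refine Subgroup.map_injective torsionFreeGroup.subtype_injective ?_
    rw [MonoidHom.map_closure, hS, ← MonoidHom.range_eq_map, Subgroup.range_subtype]
    rfl
  · rw [hgrowth]
    exact not_polynomiallyBounded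
  · rw [hgrowth]
    exact not_exponentiallyGrowing

end UpperBound

end Grigorchuk

theorem mainTheorem9 :
    (∀ (G : Type*) [Group G] (k : Type*) [Field k],
      HasIntermediateGrowth G → IsDomain (MonoidAlgebra k G) →
        IsAmenableGroup G ∧ ¬ IsElementaryAmenable G) ∧
    ((∀ g : Grigorchuk.torsionFreeGroup, g ≠ 1 → ¬ IsOfFinOrder g) ∧
      HasIntermediateGrowth Grigorchuk.torsionFreeGroup ∧
      ∀ (k : Type*) [Field k], IsDomain (MonoidAlgebra k Grigorchuk.torsionFreeGroup)) := by
  refine ⟨fun G _ k _ h _ => ⟨h.isAmenableGroup, h.not_isElementaryAmenable⟩,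
    Grigorchuk.not_isOfFinOrder, Grigorchuk.hasIntermediateGrowth, fun k _ => ?_⟩
  exact Grigorchuk.isDomain_monoidAlgebra k
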